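/- Let $P\subset\mathbb{R}^2$ be a simple polygon (the closed region bounded by a simple closed polygonal curve $\partial P$) in general position: no edge of $P$ has slope $1$ or $-1$, and no two vertices of $P$ have the same $y$-coordinate. For $p,q\in P$ let $\overline d(p,q)$ be the minimum $L_1$-length of a path in $P$ from $p$ to $q$. Let $R,B\colon[0,1]\to\partial P$ be piecewise-linear curves on the boundary of $P$; the vertices of such a curve are its points at the finitely many parameters $0=\tau_0<\dots<\tau_n=1$ between consecutive ones of which it is affine. Assume that $R$ and $B$ are simple (the preimage of each point is empty or an interval), that they are interior-disjoint (no point is on both curves other than as an endpoint of one of them), and that they are oppositely oriented (one runs clockwise along $\partial P$, the other counter-clockwise). A matching between $R$ and $B$ is a pair $(f,g)$ of non-decreasing surjections $[0,1]\to[0,1]$; it matches $R(f(t))$ to $B(g(t))$ for every $t\in[0,1]$ and has cost $\sup_{t}\overline d(R(f(t)),B(g(t)))$. The Fréchet distance is the infimum of the cost over all matchings, and a Fréchet matching is a matching that attains it. A point $b$ of $B$ is locally closest to a point $r$ if every other point $b'$ of $B$ sufficiently near $b$ satisfies $\overline d(r,b')>\overline d(r,b)$; points of $R$ locally closest to a point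 of $B$ are defined symmetrically. Then there exists a Fréchet matching $(f,g)$ between $R$ and $B$ such that for every $t\in[0,1]$, with $r=R(f(t))$ and $b=B(g(t))$, at least one of the following holds: $r$ is a vertex of $R$; $b$ is a vertex of $B$; $r$ is locally closest to $b$; $b$ is locally closest to $r$. -/

import Mathlib

open Set Topology
open scoped ENNReal unitInterval

noncomputable section

/-- The plane `ℝ²`, equipped with the `L₁`-norm `|x 0| + |x 1|`. -/
abbrev Plane : Type := PiLp 1 (fun _ : Fin 2 => ℝ)

/-! ### Simple polygons -/

/-- The closed polygonal path through the vertices of a polygon: on `[i, i + 1]` it traverses the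
edge from vertex `i` to vertex `i + 1` (indices modulo `k`) at constant speed. It has period `k`. -/
def Polygon.boundaryPath {k : ℕ} [NeZero k] (Q : Polygon Plane k) (t : ℝ) : Plane :=
  Q.edgePath ℝ (Fin.ofNat k (⌊t⌋ % (k : ℤ)).toNat) (Int.fract t)

/-- A simple polygon with `k` vertices: its closed boundary path does not meet itself. -/
structure SimplePolygon (k : ℕ) [NeZero k] extends Polygon Plane k where
  three_le : 3 ≤ k
  simple : InjOn toPolygon.boundaryPath (Ico 0 (k : ℝ))

namespace SimplePolygon

variable {k : ℕ} [NeZero k] (P : SimplePolygon k)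

/-- The boundary `∂P`, the union of the edges. -/
def bdry : Set Plane := P.toPolygon.boundary ℝ

/-- The polygon as a closed region: its boundary together with the part of the plane that the
boundary encloses, i.e. the bounded connected components of the complement of the boundary. -/
def region : Set Plane :=
  {z | z ∈ P.bdry ∨ Bornology.IsBounded (connectedComponentIn P.bdryᶜ z)}

/-- No edge has slope `1` or `-1`, and no two vertices have the same `y`-coordinate. -/
def GeneralPosition : Prop :=
  (∀ i : Fin k, |P.vertices (finRotate k i) 1 - P.vertices i 1| ≠
      |P.vertices (finRotate k i) 0 - P.vertices i 0|) ∧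
    ∀ i j : Fin k, P.vertices i 1 = P.vertices j 1 → i = j

/-- The geodesic `L₁`-distance: the infimum of the `L₁`-lengths of the paths from `p` to `q`
in `P`. The length of a path is its variation with respect to the `L₁`-norm. -/
def geodist (p q : Plane) : ℝ≥0∞ :=
  ⨅ (γ : Path p q) (_ : ∀ t, γ t ∈ P.region), eVariationOn γ univ

end SimplePolygon

/-! ### Polygonal curves -/

/-- A piecewise-linear curve, given with the (finitely many) parameters
`0 = τ 0 < τ 1 < ⋯ < τ numEdges = 1` of its vertices, between which it is affine. -/
structure PolygonalCurve where
  toFun : I → Plane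
  numEdges : ℕ
  τ : Fin (numEdges + 1) → I
  τ_strictMono : StrictMono τ
  τ_zero : τ 0 = 0
  τ_last : τ (Fin.last numEdges) = 1
  affine : ∀ (i : Fin numEdges), ∀ x ∈ Icc (τ i.castSucc) (τ i.succ),
    toFun x = AffineMap.lineMap (toFun (τ i.castSucc)) (toFun (τ i.succ))
      (((x : ℝ) - τ i.castSucc) / ((τ i.succ : ℝ) - τ i.castSucc))

namespace PolygonalCurve

instance : CoeFun PolygonalCurve (fun _ => I → Plane) := ⟨toFun⟩

/-- The point `v` is a vertex of `F`. -/
def IsVertex (F : PolygonalCurve) (v : Plane) : Prop := ∃ i, F (F.τ i) = v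

/-- The preimage of each point is empty or an interval. -/
def IsSimple (F : PolygonalCurve) : Prop := ∀ z : Plane, OrdConnected {x : I | F x = z}

/-- The points of `F` other than its two endpoints. -/
def interiorPoints (F : PolygonalCurve) : Set Plane := range F \ {F 0, F 1}

/-- The curve `F` runs along the boundary of `P` in the order in which the vertices of `P` are
listed. -/
def Forward {k : ℕ} [NeZero k] (P : SimplePolygon k) (F : PolygonalCurve) : Prop :=
  ∃ φ : I → ℝ, Continuous φ ∧ Monotone φ ∧ ∀ x, F x = P.toPolygon.boundaryPath (φ x)

/-- The curve `F` runs along the boundary of `P` against the order in which the vertices of `P` are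
listed. -/
def Backward {k : ℕ} [NeZero k] (P : SimplePolygon k) (F : PolygonalCurve) : Prop :=
  ∃ φ : I → ℝ, Continuous φ ∧ Antitone φ ∧ ∀ x, F x = P.toPolygon.boundaryPath (φ x)

/-- One curve runs clockwise along the boundary of `P` and the other one counter-clockwise. -/
def OppositelyOriented {k : ℕ} [NeZero k] (P : SimplePolygon k) (F G : PolygonalCurve) : Prop :=
  (Forward P F ∧ Backward P G) ∨ (Backward P F ∧ Forward P G)

/-- The point `b` of the curve `F` is locally closest to `r`: moving from `b` to any other
sufficiently near point of `F` increases the geodesic distance to `r`. -/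
def LocallyClosest {k : ℕ} [NeZero k] (P : SimplePolygon k) (F : PolygonalCurve)
    (b r : Plane) : Prop :=
  b ∈ range F ∧ ∀ᶠ b' in 𝓝[range F \ {b}] b, P.geodist r b < P.geodist r b'

end PolygonalCurve

/-! ### Matchings and the Fréchet distance -/

/-- A non-decreasing surjection of `[0, 1]`. -/
def IsReparam (f : I → I) : Prop := Monotone f ∧ Function.Surjective f

/-- The cost of the matching `(f, g)`, which matches `R (f t)` to `B (g t)` for every `t`. -/
def matchingCost {k : ℕ} [NeZero k] (P : SimplePolygon k) (R B : PolygonalCurve)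
    (f g : I → I) : ℝ≥0∞ :=
  ⨆ t : I, P.geodist (R (f t)) (B (g t))

/-- The `L₁`-geodesic Fréchet distance. -/
def frechetDist {k : ℕ} [NeZero k] (P : SimplePolygon k) (R B : PolygonalCurve) : ℝ≥0∞ :=
  ⨅ (f : I → I) (g : I → I) (_ : IsReparam f ∧ IsReparam g), matchingCost P R B f g

/-- A matching whose cost is the Fréchet distance, i.e. is minimum among all matchings. -/
def IsFrechetMatching {k : ℕ} [NeZero k] (P : SimplePolygon k) (R B : PolygonalCurve)
    (f g : I → I) : Prop :=
  IsReparam f ∧ IsReparam g ∧ matchingCost P R B f g = frechetDist P R B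

end

/-! ### Continuous logarithms -/

/-! Put D(x, y) = `geodist (R x) (B y)` on the parameter square. A matching traces a monotone path
between opposite corners, and the vertices of R and B cut the square into cells. Along a
nondegenerate edge the distance to a fixed boundary point is strictly quasiconvex
(`SimplePolygon.geodist_lt_max`): from an inner point c of the edge, go in a transversal coordinate
direction until a path to one end of the edge is met (`exists_chord`). As the edge is not diagonal,
the rest of that path exceeds the chord in length by a fixed amount. Hence each edge carries a
unique closest point. Moreover D is Monge (`geodist_monge`): paths in P between interlacing pairs of
boundary points cross, and their tails can be exchanged. The Monge inequality makes the closest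
point monotone in the parameter of the other curve, and strictness makes it continuous
(`exists_minimum_selection`), so the minima in a cell form monotone curves. Compactness gives a
matching of minimum cost ε (`exists_isFrechetMatching`). It is rerouted along grid lines and curves
of minima at cost at most ε (`MonoReach.of_cell`, `IsMatching.reach`). Grid lines correspond to
vertices, and minima inside edges are locally closest points. The topology rests on winding numbers,
defined by continuous logarithms of z - p: the boundary winds around interior points, while a closed
path in P winds neither around exterior points nor around boundary points that it avoids. -/

theorem exists_continuous_log {X : Type*} [TopologicalSpace X] [SimplyConnectedSpace X]
    [LocallyPathConnectedSpace X] {f : X → ℂ} (hf : Continuous f) (h0 : ∀ x, f x ≠ 0) :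
    ∃ g : X → ℂ, Continuous g ∧ ∀ x, Complex.exp (g x) = f x := by
  obtain ⟨a⟩ : Nonempty X := inferInstance
  -- The exponential is a covering of the punctured plane, so maps from simply connected spaces
  -- lift.
  obtain ⟨F, ⟨-, hF⟩, -⟩ := Complex.isCoveringMapOn_exp.existsUnique_continuousMap_lifts
    ⟨f, hf⟩ (a₀ := a) (e₀ := Complex.log (f a)) (by simp [Complex.exp_log (h0 a)]) (by simpa using h0)
  exact ⟨F, F.continuous, fun x => congrFun hF x⟩

theorem Complex.eq_of_exp_eq_of_norm_sub_lt {z w : ℂ} (h : Complex.exp z = Complex.exp w)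
    (hzw : ‖z - w‖ < 2 * Real.pi) : z = w := by
  obtain ⟨n, hn⟩ := Complex.exp_eq_exp_iff_exists_int.mp h
  have h1 : z - w = n * (2 * Real.pi * Complex.I) := by rw [hn]; ring
  rw [h1] at hzw
  have h2 : ‖(n : ℂ) * (2 * Real.pi * Complex.I)‖ = |(n : ℝ)| * (2 * Real.pi) := by
    simp [abs_of_pos Real.pi_pos]
  rw [h2] at hzw
  have h3 : |(n : ℝ)| < 1 := by
    by_contra hc
    nlinarith [Real.pi_pos]
  have h4 : n = 0 := by
    rw [← Int.cast_abs] at h3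
    have : |n| < 1 := by exact_mod_cast h3
    exact Int.abs_lt_one_iff.mp this
  rw [hn, h4]; simp

/-- Two continuous logarithms of the same function differ by a constant on a preconnected set. -/
theorem IsPreconnected.sub_eq_of_exp_eq {X : Type*} [TopologicalSpace X] {S : Set X}
    (hS : IsPreconnected S) {f g : X → ℂ} (hf : ContinuousOn f S) (hg : ContinuousOn g S)
    (h : ∀ x ∈ S, Complex.exp (f x) = Complex.exp (g x)) {x y : X} (hx : x ∈ S) (hy : y ∈ S) :
    f x - g x = f y - g y := by
  have := isPreconnected_iff_preconnectedSpace.mp hS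
  have hc : Continuous (S.domRestrict (fun x => f x - g x)) := (hf.sub hg).domRestrict
  -- The difference takes values in the discrete set 2πiℤ.
  have : IsLocallyConstant (S.domRestrict (fun x => f x - g x)) := by
    rw [IsLocallyConstant.iff_eventually_eq]
    intro z
    have := hc.continuousAt.eventually (Metric.ball_mem_nhds (S.domRestrict (fun x => f x - g x) z)
      (by positivity : 0 < 2 * Real.pi))
    filter_upwards [this] with w hw
    refine Complex.eq_of_exp_eq_of_norm_sub_lt ?_ (by simpa [dist_eq_norm] using hw)
    simp [Complex.exp_sub, h]
  exact this.apply_eq_of_preconnectedSpace ⟨x, hx⟩ ⟨y, hy⟩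

/-! ### The plane as the complex numbers -/

/-- The linear homeomorphism of the plane with the complex numbers. -/
noncomputable def toC : Plane ≃L[ℝ] ℂ :=
  ((WithLp.linearEquiv 1 ℝ (Fin 2 → ℝ)).trans
    Complex.basisOneI.equivFun.symm).toContinuousLinearEquiv

theorem toC_re (z : Plane) : (toC z).re = z 0 := by simp [toC, Complex.basisOneI, Module.Basis.ofEquivFun]

theorem toC_im (z : Plane) : (toC z).im = z 1 := by simp [toC, Complex.basisOneI, Module.Basis.ofEquivFun]

theorem toC_sub_ne_zero {z p : Plane} (h : z ≠ p) : toC (z - p) ≠ 0 := by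
  simpa [sub_eq_zero] using h

theorem Plane.norm_eq (z : Plane) : ‖z‖ = |z 0| + |z 1| := by
  simp [PiLp.norm_eq_of_L1]

theorem Plane.one_lt_rank : 1 < Module.rank ℝ Plane := by
  rw [← Module.finrank_eq_rank]
  norm_cast
  rw [toC.toLinearEquiv.finrank_eq, Complex.finrank_real_complex]; norm_num

/-- A point of a bounded open set whose frontier lies in `K` is wound around by `K`. -/
theorem not_exists_log_of_isBounded {K V : Set Plane} (hK : IsClosed K)
    (hVb : Bornology.IsBounded V) (hVK : frontier V ⊆ K) {p : Plane} (hp : p ∈ V)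
    {θ : Plane → ℂ} (hθ : ContinuousOn θ K)
    (hθp : ∀ z ∈ K, Complex.exp (θ z) = toC (z - p)) : False := by
  classical
  -- Tietze extension of the logarithm from K to the whole plane.
  obtain ⟨Θ, hΘ⟩ := ContinuousMap.exists_restrict_eq hK ⟨K.domRestrict θ, hθ.domRestrict⟩
  have hΘK : ∀ z ∈ K, Θ z = θ z := fun z hz => congrArg (fun f : C(K, ℂ) => f ⟨z, hz⟩) hΘ
  -- The two formulas agree on the frontier, where Θ is a logarithm of z - p. So g is continuous and
  -- has no zero even at p, and therefore has a global logarithm.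
  set g : Plane → ℂ := fun z => if z ∈ closure V then Complex.exp (Θ z) else toC (z - p) with hg
  have hgc : Continuous g := by
    refine Continuous.if (fun z hz => ?_) (by fun_prop) (by fun_prop)
    have : z ∈ K := hVK (frontier_closure_subset hz)
    rw [hΘK z this, hθp z this]
  have hg0 : ∀ z, g z ≠ 0 := by
    intro z
    simp only [hg]
    split_ifs with h
    · exact Complex.exp_ne_zero _
    · exact toC_sub_ne_zero fun h' => h (h' ▸ subset_closure hp)
  obtain ⟨G, hGc, hG⟩ := exists_continuous_log hgc hg0
  obtain ⟨M, hM⟩ := hVb.isCompact_closure.exists_bound_of_continuousOn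
    (f := fun z => toC (z - p)) (by fun_prop)
  have hM0 : 0 ≤ M := (norm_nonneg _).trans (hM p (subset_closure hp))
  -- On a circle around p that encloses V, g is z - p. Its logarithm must gain 2πi over one turn,
  -- yet a function of the point on the circle gains nothing.
  set c : ℝ → Plane := fun φ => p + toC.symm ((M + 1 : ℝ) * Complex.exp (φ * Complex.I)) with hc
  have hcp : ∀ φ, toC (c φ - p) = (M + 1 : ℝ) * Complex.exp (φ * Complex.I) := fun φ => by
    simp [hc]
  have hcV : ∀ φ, c φ ∉ closure V := fun φ h => by
    have := hM _ h
    simp only [hcp, norm_mul, Complex.norm_exp_ofReal_mul_I, mul_one, Complex.norm_real,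
      Real.norm_eq_abs] at this
    linarith [le_abs_self (M + 1)]
  have hM1 : ((M + 1 : ℝ) : ℂ) ≠ 0 := by
    have : M + 1 ≠ 0 := by positivity
    exact_mod_cast this
  have key := isPreconnected_univ.sub_eq_of_exp_eq (f := fun φ => G (c φ))
    (g := fun φ : ℝ => Complex.log (M + 1 : ℝ) + φ * Complex.I) (x := 0) (y := 2 * Real.pi)
    (by fun_prop) (by fun_prop)
    (fun φ _ => by simp only [hG, hg, if_neg (hcV φ), hcp, Complex.exp_add, Complex.exp_log hM1])
    (mem_univ _) (mem_univ _)
  have hc2 : c (2 * Real.pi) = c 0 := by simp [hc]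
  simp [hc2, Complex.ext_iff, Real.pi_ne_zero] at key

/-! ### Logarithmic increments along paths -/

namespace Path

variable {a b c : Plane}

theorem exists_log (γ : Path a b) {p : Plane} (hp : p ∉ range γ) :
    ∃ θ : I → ℂ, Continuous θ ∧ ∀ t, Complex.exp (θ t) = toC (γ t - p) := by
  obtain ⟨g, hg, hg'⟩ := exists_continuous_log (f := fun t : ℝ => toC (γ.extend t - p))
    (by fun_prop) fun t => toC_sub_ne_zero fun h => hp (by
      rw [← h, ← γ.extend_range]; exact mem_range_self t)
  exact ⟨fun t => g t, by fun_prop, fun t => by simp [hg']⟩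

open Classical in
/-- The increment of a continuous logarithm of `z - p` along a path that avoids `p`. -/
noncomputable def logInc (γ : Path a b) (p : Plane) : ℂ :=
  if h : ∃ θ : I → ℂ, Continuous θ ∧ ∀ t, Complex.exp (θ t) = toC (γ t - p) then
    h.choose 1 - h.choose 0 else 0

theorem logInc_eq (γ : Path a b) {p : Plane} {θ : I → ℂ} (hθ : Continuous θ)
    (h : ∀ t, Complex.exp (θ t) = toC (γ t - p)) : γ.logInc p = θ 1 - θ 0 := by
  have hex : ∃ θ : I → ℂ, Continuous θ ∧ ∀ t, Complex.exp (θ t) = toC (γ t - p) := ⟨θ, hθ, h⟩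
  rw [logInc, dif_pos hex]
  have := isPreconnected_univ.sub_eq_of_exp_eq hex.choose_spec.1.continuousOn hθ.continuousOn
    (fun t _ => by rw [h, hex.choose_spec.2]) (mem_univ (1 : I)) (mem_univ 0)
  linear_combination this

theorem logInc_eq_of_log (γ : Path a b) {p : Plane} {F : Plane → ℂ}
    (hF : ContinuousOn F (range γ)) (h : ∀ z ∈ range γ, Complex.exp (F z) = toC (z - p)) :
    γ.logInc p = F b - F a := by
  rw [γ.logInc_eq (θ := fun t => F (γ t)) (hF.comp_continuous γ.continuous (by simp))
    (fun t => h _ (mem_range_self t)), γ.source, γ.target]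

theorem logInc_trans (γ : Path a b) (γ' : Path b c) {p : Plane} (hp : p ∉ range γ)
    (hp' : p ∉ range γ') : (γ.trans γ').logInc p = γ.logInc p + γ'.logInc p := by
  obtain ⟨θ, hθ, h⟩ := (γ.trans γ').exists_log (p := p) (by rw [trans_range]; simp_all)
  rw [logInc_eq _ hθ h, γ.logInc_eq (θ := fun t => θ ⟨t / 2, by
      have := t.2.1; have := t.2.2; constructor <;> linarith⟩) (by fun_prop) ?_,
    γ'.logInc_eq (θ := fun t => θ ⟨(t + 1) / 2, by
      have := t.2.1; have := t.2.2; constructor <;> linarith⟩) (by fun_prop) ?_]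
  · have e0 : (⟨((0 : I) : ℝ) / 2, by norm_num⟩ : I) = 0 := by ext; simp
    have e1 : (⟨((1 : I) : ℝ) / 2, by norm_num⟩ : I) = ⟨(((0 : I) : ℝ) + 1) / 2, by norm_num⟩ := by
      ext; simp
    have e2 : (⟨(((1 : I) : ℝ) + 1) / 2, by norm_num⟩ : I) = 1 := by ext; norm_num
    simp only [e0, e1, e2]; ring
  · intro t
    rw [h, trans_apply]
    have h0 := t.2.1
    have h1 := t.2.2
    split_ifs with ht
    · have : (⟨((t : ℝ) + 1) / 2, by constructor <;> linarith⟩ : I) = ⟨1 / 2, by norm_num⟩ := by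
        ext; simp at ht ⊢; linarith
      have ht0 : t = 0 := by
        ext
        rw [Icc.coe_zero]
        norm_num at ht
        linarith
      simp [ht0]
    · congr 3; ext; simp; ring
  · intro t
    rw [h, trans_apply]
    have h1 := t.2.2
    rw [dif_pos (by simp; linarith)]
    congr 3; ext; simp; ring

/-- Moving the base point changes the logarithmic increment by that of the quotient. -/
theorem logInc_eq_add_log (γ : Path a b) {p q : Plane} (hp : p ∉ range γ) (μ : ℂ)
    (h : ∀ z ∈ range γ, μ * (toC (z - q) / toC (z - p)) ∈ Complex.slitPlane) :
    γ.logInc q = γ.logInc p + (Complex.log (μ * (toC (b - q) / toC (b - p))) -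
      Complex.log (μ * (toC (a - q) / toC (a - p)))) := by
  obtain ⟨θ, hθ, hθp⟩ := γ.exists_log hp
  have h0 : ∀ t, toC (γ t - p) ≠ 0 := fun t =>
    toC_sub_ne_zero fun h' => hp (h' ▸ mem_range_self t)
  have hne : ∀ t, μ * (toC (γ t - q) / toC (γ t - p)) ≠ 0 := fun t =>
    Complex.slitPlane_ne_zero (h _ (mem_range_self t))
  have hμ : μ ≠ 0 := left_ne_zero_of_mul (hne 0)
  -- The factor μ only turns the quotient away from the branch cut; its logarithm cancels in the
  -- increment.
  rw [γ.logInc_eq hθ hθp, γ.logInc_eq (p := q) (θ := fun t => θ t +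
    Complex.log (μ * (toC (γ t - q) / toC (γ t - p))) - Complex.log μ) ?_ ?_]
  · simp only [γ.source, γ.target]; ring
  · exact (hθ.add (Continuous.clog (continuous_const.mul
      (Continuous.div (by fun_prop) (by fun_prop) h0)) fun t => h _ (mem_range_self t))).sub
        continuous_const
  · intro t
    rw [Complex.exp_sub, Complex.exp_add, hθp, Complex.exp_log (hne t), Complex.exp_log hμ]
    have := h0 t
    field_simp

/-- The quotient of `z - q` and `z - p` is close to `1` for `q` near `p`. -/
theorem eventually_div_mem_slitPlane (γ : Path a b) {p : Plane} (hp : p ∉ range γ) :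
    ∀ᶠ q in 𝓝 p, ∀ z ∈ range γ, toC (z - q) / toC (z - p) ∈ Complex.slitPlane := by
  have hc : IsCompact (range γ) := isCompact_range γ.continuous
  obtain ⟨z0, hz0, hmin⟩ := hc.exists_isMinOn (range_nonempty γ)
    (f := fun z => ‖toC (z - p)‖) (by fun_prop)
  have hpos : 0 < ‖toC (z0 - p)‖ :=
    norm_pos_iff.mpr (toC_sub_ne_zero fun h => hp (h ▸ hz0))
  have hcont : ContinuousAt (fun q => ‖toC (q - p)‖) p := by fun_prop
  have hlt : (fun q => ‖toC (q - p)‖) p < ‖toC (z0 - p)‖ := by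
    simpa only [sub_self, map_zero, norm_zero] using hpos
  have := hcont.eventually_lt_const hlt
  filter_upwards [this] with q hq z hz
  left
  have h1 : ‖toC (q - p)‖ < ‖toC (z - p)‖ := hq.trans_le (hmin hz)
  have hz' : toC (z - p) ≠ 0 := norm_pos_iff.mp ((norm_nonneg _).trans_lt h1)
  have h2 : toC (z - q) / toC (z - p) = 1 - toC (q - p) / toC (z - p) := by
    rw [eq_sub_iff_add_eq, ← add_div, ← map_add, sub_add_sub_cancel, div_self hz']
  have h3 : ‖toC (q - p) / toC (z - p)‖ < 1 := by
    rw [norm_div, div_lt_one (norm_pos_iff.mpr hz')]; exact h1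
  have h4 := (Complex.re_le_norm (toC (q - p) / toC (z - p))).trans_lt h3
  rw [h2, Complex.sub_re, Complex.one_re]
  linarith

/-- On a closed path the two correction logarithms of `logInc_eq_add_log` coincide, so the winding
is locally constant in the base point. -/
theorem eventually_logInc_eq (γ : Path a a) {p : Plane} (hp : p ∉ range γ) :
    ∀ᶠ q in 𝓝 p, q ∉ range γ ∧ γ.logInc q = γ.logInc p := by
  filter_upwards [γ.eventually_div_mem_slitPlane hp,
    (isCompact_range γ.continuous).isClosed.isOpen_compl.mem_nhds hp] with q hq hq'
  exact ⟨hq', by rw [γ.logInc_eq_add_log hp 1 (by simpa only [one_mul] using hq)]; ring⟩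

theorem logInc_eq_of_isPreconnected (γ : Path a a) {S : Set Plane} (hS : IsPreconnected S)
    (hd : Disjoint S (range γ)) {p q : Plane} (hp : p ∈ S) (hq : q ∈ S) :
    γ.logInc p = γ.logInc q := by
  have := isPreconnected_iff_preconnectedSpace.mp hS
  have hl : IsLocallyConstant (S.domRestrict γ.logInc) := by
    rw [IsLocallyConstant.iff_eventually_eq]
    intro z
    have := γ.eventually_logInc_eq (disjoint_left.mp hd z.2)
    exact (continuous_subtype_val.continuousAt.eventually this).mono fun w hw => hw.2
  exact hl.apply_eq_of_preconnectedSpace ⟨p, hp⟩ ⟨q, hq⟩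

/-- The winding is constant on S, and S contains a point q farther out than the whole path. There z
- q = -q (1 - z/q) has a logarithm in z, because 1 - z/q has positive real part. -/
theorem logInc_eq_zero_of_not_isBounded (γ : Path a a) {S : Set Plane} (hS : IsPreconnected S)
    (hd : Disjoint S (range γ)) (hb : ¬ Bornology.IsBounded S) {p : Plane} (hp : p ∈ S) :
    γ.logInc p = 0 := by
  obtain ⟨M, hM⟩ := (isCompact_range γ.continuous).exists_bound_of_continuousOn
    (f := toC) (by fun_prop)
  obtain ⟨q, hqS, hq⟩ : ∃ q ∈ S, M < ‖toC q‖ := by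
    by_contra! hcon
    refine hb ?_
    have : S ⊆ toC.symm '' Metric.closedBall 0 M := fun z hz =>
      ⟨toC z, by simpa using hcon z hz, by simp⟩
    exact ((isCompact_closedBall (0 : ℂ) M).image toC.symm.continuous).isBounded.subset this
  rw [γ.logInc_eq_of_isPreconnected hS hd hp hqS]
  have hM0 : 0 ≤ M := (norm_nonneg _).trans (hM a ⟨0, γ.source⟩)
  have hq0 : toC q ≠ 0 := norm_pos_iff.mp (hM0.trans_lt hq)
  have hs : ∀ z ∈ range γ, 1 - toC z / toC q ∈ Complex.slitPlane := by
    intro z hz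
    left
    have h3 : ‖toC z / toC q‖ < 1 := by
      rw [norm_div, div_lt_one (norm_pos_iff.mpr hq0)]; exact (hM z hz).trans_lt hq
    have h4 := (Complex.re_le_norm (toC z / toC q)).trans_lt h3
    rw [Complex.sub_re, Complex.one_re]
    linarith
  rw [γ.logInc_eq_of_log (p := q)
    (F := fun z => Complex.log (- toC q) + Complex.log (1 - toC z / toC q)), sub_self]
  · refine continuousOn_const.add (ContinuousOn.clog ?_ hs)
    fun_prop
  · intro z hz
    rw [Complex.exp_add, Complex.exp_log (neg_ne_zero.mpr hq0),
      Complex.exp_log (Complex.slitPlane_ne_zero (hs z hz)), map_sub]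
    field_simp
    ring

end Path

/-! ### The boundary of a polygon as a closed path -/

namespace Polygon

variable {k : ℕ} [NeZero k] (Q : Polygon Plane k)

/-- The vertices of a polygon, indexed periodically by the integers. -/
def vert (n : ℤ) : Plane := Q.vertices (Fin.ofNat k (n % (k : ℤ)).toNat)

theorem finRotate_ofNat_emod (n : ℤ) :
    finRotate k (Fin.ofNat k (n % (k : ℤ)).toNat) = Fin.ofNat k ((n + 1) % (k : ℤ)).toNat := by
  have hk : (0 : ℤ) < (k : ℤ) := by exact_mod_cast Nat.pos_of_ne_zero (NeZero.ne k)
  rw [finRotate_apply]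
  ext
  simp only [Fin.ofNat_eq_cast, Fin.val_add, Fin.val_natCast]
  zify
  rw [Int.toNat_of_nonneg (Int.emod_nonneg _ hk.ne'), Int.toNat_of_nonneg (Int.emod_nonneg _ hk.ne')]
  have h1 : (((1 : Fin k) : ℕ) : ℤ) % (k : ℤ) = 1 % (k : ℤ) := by
    rw [Fin.val_one']; simp
  rw [Int.emod_emod_of_dvd _ dvd_rfl, Int.emod_emod_of_dvd _ dvd_rfl, Int.add_emod,
    Int.emod_emod_of_dvd _ dvd_rfl, h1, ← Int.add_emod]

theorem boundaryPath_eq_lineMap (n : ℤ) {t : ℝ} (ht : t ∈ Icc (n : ℝ) (n + 1)) :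
    Q.boundaryPath t = AffineMap.lineMap (Q.vert n) (Q.vert (n + 1)) (t - n) := by
  -- At t = n + 1 the floor already selects the next edge, whose start is the end of this one.
  rcases ht.2.eq_or_lt with h | h
  · have h1 : ⌊t⌋ = n + 1 := by rw [h]; exact_mod_cast Int.floor_intCast (n + 1)
    have h2 : Int.fract t = 0 := by rw [Int.fract, h1, h]; push_cast; ring
    have h3 : t - n = 1 := by rw [h]; ring
    rw [boundaryPath, h1, h2, h3, edgePath, AffineMap.lineMap_apply_zero,
      AffineMap.lineMap_apply_one]
    rfl
  · have h1 : ⌊t⌋ = n := Int.floor_eq_iff.mpr ⟨ht.1, h⟩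
    rw [boundaryPath, edgePath, Int.fract, h1, finRotate_ofNat_emod]
    rfl

theorem continuous_boundaryPath : Continuous Q.boundaryPath := by
  have hlf : LocallyFinite (fun n : ℤ => Icc (n : ℝ) (n + 1)) :=
    locallyFinite_Icc_of_tendsto tendsto_intCast_atTop_atTop
      (Filter.tendsto_atBot_add_const_right _ _ (tendsto_intCast_atBot_iff.mpr Filter.tendsto_id))
  refine hlf.continuous ?_ (fun _ => isClosed_Icc) fun n => ?_
  · exact iUnion_eq_univ_iff.mpr fun t => ⟨⌊t⌋, Int.floor_le t, (Int.lt_floor_add_one t).le⟩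
  · refine ContinuousOn.congr (f := fun t : ℝ =>
      AffineMap.lineMap (Q.vert n) (Q.vert (n + 1)) (t - n)) ?_
      fun t ht => Q.boundaryPath_eq_lineMap n ht
    exact (AffineMap.lineMap_continuous.comp (by fun_prop)).continuousOn

theorem boundaryPath_add_int_mul (t : ℝ) (m : ℤ) :
    Q.boundaryPath (t + m * k) = Q.boundaryPath t := by
  have h : t + m * k = t + ((m * k : ℤ) : ℝ) := by push_cast; ring
  rw [boundaryPath, h, Int.floor_add_intCast, Int.fract_add_intCast, Int.add_mul_emod_self_right]
  rfl

theorem boundaryPath_add_period (t : ℝ) : Q.boundaryPath (t + k) = Q.boundaryPath t := by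
  simpa using Q.boundaryPath_add_int_mul t 1

theorem range_boundaryPath : range Q.boundaryPath = Q.boundary ℝ := by
  ext z
  simp only [boundary, mem_range, mem_iUnion]
  constructor
  · rintro ⟨t, rfl⟩
    exact ⟨_, Int.fract t, ⟨Int.fract_nonneg t, (Int.fract_lt_one t).le⟩, rfl⟩
  · rintro ⟨i, x, hx, rfl⟩
    refine ⟨(i : ℕ) + x, ?_⟩
    have h0 : ((i : ℕ) : ℤ) % (k : ℤ) = ((i : ℕ) : ℤ) :=
      Int.emod_eq_of_lt (by positivity) (by exact_mod_cast i.2)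
    have h1 : Fin.ofNat k (((i : ℕ) : ℤ) % (k : ℤ)).toNat = i := by
      rw [h0]; ext; simp
    have h2 := Q.boundaryPath_eq_lineMap ((i : ℕ) : ℤ) (t := (i : ℕ) + x)
      ⟨by push_cast; linarith [hx.1], by push_cast; linarith [hx.2]⟩
    rw [h2, vert, vert, ← finRotate_ofNat_emod, h1]
    congr 1
    push_cast; ring

end Polygon

namespace SimplePolygon

variable {k : ℕ} [NeZero k] (P : SimplePolygon k)

theorem period_pos : (0 : ℝ) < k := by
  exact_mod_cast Nat.pos_of_ne_zero (NeZero.ne k)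

theorem boundaryPath_mem (t : ℝ) : P.toPolygon.boundaryPath t ∈ P.bdry := by
  rw [bdry, ← Polygon.range_boundaryPath]; exact mem_range_self t

theorem exists_boundaryPath_eq {z : Plane} (hz : z ∈ P.bdry) (s : ℝ) :
    ∃ t ∈ Ico s (s + k), P.toPolygon.boundaryPath t = z := by
  rw [bdry, ← Polygon.range_boundaryPath] at hz
  obtain ⟨t, rfl⟩ := hz
  refine ⟨toIcoMod (period_pos (k := k)) s t, toIcoMod_mem_Ico _ _ _, ?_⟩
  have := P.toPolygon.boundaryPath_add_int_mul t (-toIcoDiv (period_pos (k := k)) s t)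
  rw [← this, toIcoMod]
  congr 1
  rw [zsmul_eq_mul]
  push_cast; ring

theorem boundaryPath_eq_iff {s t : ℝ} :
    P.toPolygon.boundaryPath s = P.toPolygon.boundaryPath t ↔ ∃ m : ℤ, s = t + m * k := by
  constructor
  · intro h
    have h1 : ∀ u : ℝ, P.toPolygon.boundaryPath (toIcoMod (period_pos (k := k)) 0 u) =
        P.toPolygon.boundaryPath u := fun u => by
      have := P.toPolygon.boundaryPath_add_int_mul u (-toIcoDiv (period_pos (k := k)) 0 u)
      rw [← this, toIcoMod]
      congr 1
      rw [zsmul_eq_mul]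
      push_cast; ring
    have hm : ∀ u : ℝ, toIcoMod (period_pos (k := k)) 0 u ∈ Ico 0 (k : ℝ) := fun u => by
      simpa using toIcoMod_mem_Ico (period_pos (k := k)) 0 u
    have h2 := P.simple (hm s) (hm t) (by rw [h1, h1, h])
    refine ⟨toIcoDiv (period_pos (k := k)) 0 s - toIcoDiv (period_pos (k := k)) 0 t, ?_⟩
    simp only [toIcoMod, zsmul_eq_mul] at h2
    push_cast
    linarith
  · rintro ⟨m, rfl⟩
    exact P.toPolygon.boundaryPath_add_int_mul t m

theorem eq_of_boundaryPath_eq {s t : ℝ}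
    (h : P.toPolygon.boundaryPath s = P.toPolygon.boundaryPath t) (hst : |s - t| < k) : s = t := by
  obtain ⟨m, hm⟩ := P.boundaryPath_eq_iff.mp h
  have hk : (0 : ℝ) < k := period_pos
  have h1 : s - t = m * k := by linarith
  rw [h1, abs_mul, abs_of_pos hk] at hst
  have h2 : |(m : ℝ)| < 1 := by
    by_contra hc
    nlinarith
  have h3 : m = 0 := by
    rw [← Int.cast_abs] at h2
    exact Int.abs_lt_one_iff.mp (by exact_mod_cast h2)
  simp [hm, h3]

theorem isCompact_bdry : IsCompact P.bdry := by
  have : P.bdry = P.toPolygon.boundaryPath '' Icc 0 (k : ℝ) := by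
    ext z
    constructor
    · intro hz
      obtain ⟨t, ht, rfl⟩ := P.exists_boundaryPath_eq hz 0
      exact ⟨t, ⟨ht.1, by linarith [ht.2]⟩, rfl⟩
    · rintro ⟨t, -, rfl⟩
      exact P.boundaryPath_mem t
  rw [this]
  exact isCompact_Icc.image P.toPolygon.continuous_boundaryPath

/-! ### The exterior of a polygon -/

theorem bdry_subset_region : P.bdry ⊆ P.region := fun _ hz => Or.inl hz

theorem isPreconnected_norm_gt (M : ℝ) (hM : 0 ≤ M) : IsPreconnected {z : Plane | M < ‖z‖} := by
  have h := ((isPreconnected_sphere Plane.one_lt_rank (0 : Plane) 1).prod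
    (isPreconnected_Ioi (a := M))).image (fun x : Plane × ℝ => x.2 • x.1) (by fun_prop)
  convert h using 1
  ext z
  simp only [mem_ofPred_eq, mem_image, mem_prod, mem_sphere_zero_iff_norm, mem_Ioi, Prod.exists]
  constructor
  · intro hz
    have h0 : ‖z‖ ≠ 0 := by linarith
    exact ⟨‖z‖⁻¹ • z, ‖z‖, ⟨by rw [norm_smul, norm_inv, norm_norm, inv_mul_cancel₀ h0], hz⟩,
      by rw [smul_smul, mul_inv_cancel₀ h0, one_smul]⟩
  · rintro ⟨u, r, ⟨hu, hr⟩, rfl⟩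
    rw [norm_smul, hu, mul_one, Real.norm_of_nonneg (hM.trans hr.le)]
    exact hr

theorem not_isBounded_norm_gt (M : ℝ) : ¬ Bornology.IsBounded {z : Plane | M < ‖z‖} := by
  intro h
  obtain ⟨C, hC⟩ := h.exists_norm_le
  have h1 := hC (toC.symm ((max M C + 1 : ℝ) : ℂ))
  have hn : ‖toC.symm ((max M C + 1 : ℝ) : ℂ)‖ = |max M C + 1| := by
    rw [Plane.norm_eq, ← toC_re, ← toC_im]; simp
  simp only [mem_ofPred_eq, hn] at h1
  have h2 := le_abs_self (max M C + 1)
  have h3 := h1 (by linarith [le_max_left M C])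
  linarith [le_max_right M C]

/-- The points far from the origin form a connected set that avoids the boundary. Every unbounded
component meets this set, so there is exactly one, and it is the complement of the region. -/
theorem exists_compl_region_eq : ∃ w ∈ P.bdryᶜ, P.regionᶜ = connectedComponentIn P.bdryᶜ w ∧
    ∃ M : ℝ, {z : Plane | M < ‖z‖} ⊆ P.regionᶜ := by
  obtain ⟨M, hM⟩ := P.isCompact_bdry.isBounded.exists_norm_le
  have hM0 : 0 ≤ M := (norm_nonneg _).trans (hM _ (P.boundaryPath_mem 0))
  set E := {z : Plane | M < ‖z‖} with hE
  have hEJ : E ⊆ P.bdryᶜ := fun z hz hzJ => (hM z hzJ).not_gt hz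
  obtain ⟨w, hw⟩ : E.Nonempty := by
    by_contra hne
    rw [not_nonempty_iff_eq_empty] at hne
    exact not_isBounded_norm_gt M (by rw [← hE, hne]; exact Bornology.isBounded_empty)
  have hEw : E ⊆ connectedComponentIn P.bdryᶜ w :=
    (isPreconnected_norm_gt M hM0).subset_connectedComponentIn hw hEJ
  have heq : P.regionᶜ = connectedComponentIn P.bdryᶜ w := by
    ext z
    simp only [region, mem_compl_iff, mem_ofPred_eq, not_or]
    constructor
    · rintro ⟨hz, hzb⟩
      obtain ⟨x, hx, hxM⟩ : ∃ x ∈ connectedComponentIn P.bdryᶜ z, M < ‖x‖ := by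
        by_contra! hcon
        exact hzb ((Metric.isBounded_closedBall (x := (0 : Plane)) (r := M)).subset
          fun x hx => by simpa using hcon x hx)
      rw [connectedComponentIn_eq (hEw hxM), ← connectedComponentIn_eq hx]
      exact mem_connectedComponentIn hz
    · intro hz
      refine ⟨connectedComponentIn_subset _ _ hz, fun hb => ?_⟩
      rw [← connectedComponentIn_eq hz] at hb
      exact not_isBounded_norm_gt M (hb.subset hEw)
  exact ⟨w, hEJ hw, heq, M, heq ▸ hEw⟩

theorem isPreconnected_compl_region : IsPreconnected P.regionᶜ := by
  obtain ⟨w, -, h, -⟩ := P.exists_compl_region_eq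
  rw [h]; exact isPreconnected_connectedComponentIn

theorem isOpen_compl_region : IsOpen P.regionᶜ := by
  obtain ⟨w, -, h, -⟩ := P.exists_compl_region_eq
  rw [h]; exact P.isCompact_bdry.isClosed.isOpen_compl.connectedComponentIn

theorem isBounded_region : Bornology.IsBounded P.region := by
  obtain ⟨w, -, -, M, h⟩ := P.exists_compl_region_eq
  refine (Metric.isBounded_closedBall (x := (0 : Plane)) (r := M)).subset fun z hz => ?_
  by_contra hc
  exact h (show M < ‖z‖ by simpa using hc) hz

theorem not_isBounded_compl_region : ¬ Bornology.IsBounded P.regionᶜ := by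
  obtain ⟨w, -, -, M, h⟩ := P.exists_compl_region_eq
  exact fun hb => not_isBounded_norm_gt M (hb.subset h)

/-- A limit point of the exterior off the boundary could be adjoined to the exterior without
disconnecting it, and the exterior is a full component. -/
theorem closure_compl_region_subset : closure P.regionᶜ ⊆ P.regionᶜ ∪ P.bdry := by
  obtain ⟨w, hw, h, -⟩ := P.exists_compl_region_eq
  intro z hz
  by_contra! hc
  rw [mem_union, not_or] at hc
  have hpre : IsPreconnected (insert z P.regionᶜ) :=
    P.isPreconnected_compl_region.subset_closure (subset_insert _ _)
      (insert_subset hz subset_closure)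
  have hsub : insert z P.regionᶜ ⊆ P.bdryᶜ :=
    insert_subset hc.2 (compl_subset_compl.mpr P.bdry_subset_region)
  have h2 := hpre.subset_connectedComponentIn
    (mem_insert_of_mem _ (h ▸ mem_connectedComponentIn hw)) hsub
  exact hc.1 (h ▸ h2 (mem_insert _ _))

/-- A closed path in a polygon does not wind around the points outside. -/
theorem logInc_eq_zero_of_notMem_region {a : Plane} (γ : Path a a) (hγ : range γ ⊆ P.region)
    {p : Plane} (hp : p ∉ P.region) : γ.logInc p = 0 :=
  γ.logInc_eq_zero_of_not_isBounded P.isPreconnected_compl_region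
    (disjoint_left.mpr fun _ hz hz' => hz (hγ hz')) P.not_isBounded_compl_region hp

end SimplePolygon

/-! ### Crossing paths in a polygon -/

/-- A frontier point outside K could be adjoined to the component, against maximality. -/
theorem frontier_connectedComponentIn_compl_subset {K : Set Plane} (hK : IsClosed K) (p : Plane) :
    frontier (connectedComponentIn Kᶜ p) ⊆ K := by
  intro z hz
  by_contra hzK
  rw [hK.isOpen_compl.connectedComponentIn.frontier_eq] at hz
  have hp : p ∈ Kᶜ := by
    by_contra hp
    simp [connectedComponentIn_eq_empty hp] at hz
  have hpre : IsPreconnected (insert z (connectedComponentIn Kᶜ p)) :=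
    isPreconnected_connectedComponentIn.subset_closure (subset_insert _ _)
      (insert_subset hz.1 subset_closure)
  exact hz.2 (hpre.subset_connectedComponentIn (mem_insert_of_mem _ (mem_connectedComponentIn hp))
    (insert_subset hzK (connectedComponentIn_subset _ _)) (mem_insert _ _))

/-- If `z - p` has a continuous logarithm along a parametrized compact set that is compatible with
the parametrization, then `p` does not lie in a bounded open set with frontier in the compact set. -/
theorem not_exists_log_of_image_Icc {β : ℝ → Plane} (hβ : Continuous β) {s t : ℝ} {V : Set Plane}
    (hVb : Bornology.IsBounded V) (hV : frontier V ⊆ β '' Icc s t) {p : Plane} (hp : p ∈ V)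
    {θ : ℝ → ℂ} (hθ : Continuous θ) (hθp : ∀ u ∈ Icc s t, Complex.exp (θ u) = toC (β u - p))
    (hcomp : ∀ u ∈ Icc s t, ∀ v ∈ Icc s t, β u = β v → θ u = θ v) : False := by
  classical
  set Θ : Plane → ℂ := fun z => if h : ∃ u ∈ Icc s t, β u = z then θ h.choose else 0 with hΘ
  have hΘβ : ∀ u ∈ Icc s t, Θ (β u) = θ u := by
    intro u hu
    have h : ∃ v ∈ Icc s t, β v = β u := ⟨u, hu, rfl⟩
    simp only [hΘ, dif_pos h]
    exact hcomp _ h.choose_spec.1 _ hu h.choose_spec.2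
  refine not_exists_log_of_isBounded (isCompact_Icc.image hβ).isClosed hVb hV hp (θ := Θ) ?_ ?_
  -- No inverse of β is needed: preimages of closed sets under Θ are, within the image, β-images of
  -- compact sets.
  · rw [continuousOn_iff_isClosed]
    intro C hC
    refine ⟨β '' (Icc s t ∩ θ ⁻¹' C),
      ((isCompact_Icc.inter_right (hC.preimage hθ)).image hβ).isClosed, ?_⟩
    ext z
    constructor
    · rintro ⟨hz, u, hu, rfl⟩
      exact ⟨⟨u, ⟨hu, by simpa [hΘβ u hu] using hz⟩, rfl⟩, u, hu, rfl⟩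
    · rintro ⟨⟨u, ⟨hu, hz⟩, rfl⟩, hK⟩
      exact ⟨by simpa [hΘβ u hu] using hz, hK⟩
  · rintro _ ⟨u, hu, rfl⟩
    rw [hΘβ u hu, hθp u hu]

/-! ### Winding of the boundary, and of closed paths in the polygon -/

namespace SimplePolygon

variable {k : ℕ} [NeZero k] (P : SimplePolygon k)

theorem exists_log_boundaryPath {p : Plane} (hp : p ∉ P.bdry) : ∃ θ : ℝ → ℂ, Continuous θ ∧
    ∀ t, Complex.exp (θ t) = toC (P.toPolygon.boundaryPath t - p) := by
  have := P.toPolygon.continuous_boundaryPath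
  exact exists_continuous_log (by fun_prop)
    fun t => toC_sub_ne_zero fun h => hp (h ▸ P.boundaryPath_mem t)

/-- The boundary of a polygon winds around the interior points. -/
theorem log_add_period_ne {p : Plane} (hp : p ∉ P.bdry) (hpr : p ∈ P.region) {θ : ℝ → ℂ}
    (hθ : Continuous θ) (hθp : ∀ t, Complex.exp (θ t) = toC (P.toPolygon.boundaryPath t - p))
    (s : ℝ) : θ (s + k) ≠ θ s := by
  intro hs
  -- If θ returned once to its value it would be periodic and hence descend to a logarithm of z - p
  -- on the boundary, whereas p lies in a bounded component.
  have hper : Function.Periodic θ (k : ℝ) := fun u => by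
    have := isPreconnected_univ.sub_eq_of_exp_eq (f := fun u => θ (u + k)) (g := θ)
      (by fun_prop) (by fun_prop)
      (fun u _ => by rw [hθp, hθp, Polygon.boundaryPath_add_period]) (mem_univ u) (mem_univ s)
    rw [hs, sub_self] at this
    exact sub_eq_zero.mp this
  have hJ : P.bdry ⊆ P.toPolygon.boundaryPath '' Icc 0 (k : ℝ) := fun z hz => by
    obtain ⟨t, ht, rfl⟩ := P.exists_boundaryPath_eq hz 0
    exact ⟨t, ⟨ht.1, by linarith [ht.2]⟩, rfl⟩
  refine not_exists_log_of_image_Icc (V := connectedComponentIn P.bdryᶜ p)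
    P.toPolygon.continuous_boundaryPath (hpr.resolve_left hp)
    ((frontier_connectedComponentIn_compl_subset P.isCompact_bdry.isClosed p).trans hJ)
    (mem_connectedComponentIn hp) hθ (fun u _ => hθp u) fun u _ v _ huv => ?_
  obtain ⟨m, rfl⟩ := P.boundaryPath_eq_iff.mp huv
  exact hper.int_mul m v

/-- Every boundary point of a polygon is a limit of exterior points. -/
theorem bdry_subset_closure_compl_region : P.bdry ⊆ closure P.regionᶜ := by
  intro q hq
  by_contra hqU
  obtain ⟨s, -, rfl⟩ := P.exists_boundaryPath_eq hq 0
  set β := P.toPolygon.boundaryPath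
  have hβ : Continuous β := P.toPolygon.continuous_boundaryPath
  have hk : (0 : ℝ) < k := period_pos
  obtain ⟨δ, hδ, hball⟩ := Metric.isOpen_iff.mp (isClosed_closure.isOpen_compl.preimage hβ) s hqU
  -- The bound δ / 2 keeps the arc removed around s away from the closure of the exterior; k / 4
  -- keeps the remaining parameter interval nonempty. What remains is an arc A, and an arc does not
  -- separate the plane.
  set ε := min (δ / 2) (k / 4 : ℝ)
  have hε : 0 < ε := by positivity
  have hε1 : ε ≤ δ / 2 := min_le_left _ _
  have hε2 : ε ≤ k / 4 := min_le_right _ _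
  set A := β '' Icc (s + ε) (s + k - ε) with hA
  have hAc : IsClosed A := (isCompact_Icc.image hβ).isClosed
  have hqA : β s ∉ A := by
    rintro ⟨u, hu, huq⟩
    have := P.eq_of_boundaryPath_eq huq (by rw [abs_lt]; constructor <;> linarith [hu.1, hu.2])
    linarith [hu.1]
  have hAJ : A ⊆ P.bdry := by
    rintro _ ⟨u, -, rfl⟩; exact P.boundaryPath_mem u
  have hJA : ∀ z ∈ P.bdry, z ∉ A → z ∉ closure P.regionᶜ := by
    intro z hz hzA
    obtain ⟨t, ht, rfl⟩ := P.exists_boundaryPath_eq hz (s - ε)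
    have ht' : t < s + ε := by
      by_contra hc
      exact hzA ⟨t, ⟨not_lt.mp hc, by linarith [ht.2]⟩, rfl⟩
    exact hball (by rw [Metric.mem_ball, Real.dist_eq, abs_lt]; constructor <;> linarith [ht.1])
  -- In the complement of A the exterior has no limit points outside itself: these would lie on the
  -- removed arc. If the component of β s met the exterior it would lie inside it, but β s does not.
  have hVU : Disjoint (connectedComponentIn Aᶜ (β s)) P.regionᶜ := by
    rw [disjoint_left]
    intro z hzV hzU
    have hsub : connectedComponentIn Aᶜ (β s) ⊆ P.regionᶜ := by
      refine isPreconnected_connectedComponentIn.subset_of_closure_inter_subset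
        P.isOpen_compl_region ⟨z, hzV, hzU⟩ fun x hx => ?_
      refine (P.closure_compl_region_subset hx.1).resolve_right fun hxJ => ?_
      exact hJA x hxJ (connectedComponentIn_subset _ _ hx.2) hx.1
    exact hsub (mem_connectedComponentIn hqA) (P.bdry_subset_region (P.boundaryPath_mem s))
  have hVb : Bornology.IsBounded (connectedComponentIn Aᶜ (β s)) :=
    P.isBounded_region.subset fun z hz => not_not.mp (disjoint_left.mp hVU hz)
  obtain ⟨θ, hθ, hθp⟩ := exists_continuous_log
    (f := fun t => toC (β (projIcc (s + ε) (s + k - ε) (by linarith) t) - β s))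
    (by fun_prop) fun t => toC_sub_ne_zero fun h => hqA ⟨_, Subtype.coe_prop _, h⟩
  refine not_exists_log_of_image_Icc hβ hVb (frontier_connectedComponentIn_compl_subset hAc _)
    (mem_connectedComponentIn hqA) hθ (fun u hu => by rw [hθp, projIcc_of_mem _ hu])
    fun u hu v hv huv => ?_
  -- The interval is shorter than a period, so β is injective on it and every logarithm is
  -- compatible.
  rw [P.eq_of_boundaryPath_eq huv (by rw [abs_lt]; constructor <;> linarith [hu.1, hu.2, hv.1, hv.2])]

/-- A closed path in a polygon does not wind around the boundary points that it avoids. -/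
theorem logInc_eq_zero_of_mem_bdry {a : Plane} (γ : Path a a) (hγ : range γ ⊆ P.region)
    {p : Plane} (hp : p ∈ P.bdry) (hpγ : p ∉ range γ) : γ.logInc p = 0 := by
  -- The winding is the same at nearby exterior points, where it vanishes.
  obtain ⟨q, hq, hqU⟩ := mem_closure_iff_nhds.mp (P.bdry_subset_closure_compl_region hp) _
    (γ.eventually_logInc_eq hpγ)
  rw [← hq.2, P.logInc_eq_zero_of_notMem_region γ hγ hqU]

/-- The path along the boundary between two parameters. -/
noncomputable def arc (s t : ℝ) : Path (P.toPolygon.boundaryPath s) (P.toPolygon.boundaryPath t) where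
  toFun u := P.toPolygon.boundaryPath (AffineMap.lineMap s t (u : ℝ))
  continuous_toFun := P.toPolygon.continuous_boundaryPath.comp
    (AffineMap.lineMap_continuous.comp continuous_subtype_val)
  source' := by simp
  target' := by simp

theorem range_arc (s t : ℝ) : range (P.arc s t) = P.toPolygon.boundaryPath '' uIcc s t := by
  rw [← segment_eq_uIcc, segment_eq_image_lineMap, ← image_comp, image_eq_range]
  rfl

theorem logInc_arc (s t : ℝ) {p : Plane} {θ : ℝ → ℂ} (hθ : Continuous θ)
    (hθp : ∀ t, Complex.exp (θ t) = toC (P.toPolygon.boundaryPath t - p)) :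
    (P.arc s t).logInc p = θ t - θ s := by
  have := (P.arc s t).logInc_eq (θ := fun u => θ (AffineMap.lineMap s t (u : ℝ)))
    (hθ.comp (AffineMap.lineMap_continuous.comp continuous_subtype_val)) (fun u => hθp _)
  simpa using this

/-- Two paths in a polygon that connect interlacing pairs of boundary points intersect. -/
theorem exists_mem_range_of_interlacing {s₁ s₂ s₃ s₄ : ℝ} (h₁₂ : s₁ ≤ s₂) (h₂₃ : s₂ ≤ s₃)
    (h₃₄ : s₃ ≤ s₄) (h₄₁ : s₄ ≤ s₁ + k)
    (γ : Path (P.toPolygon.boundaryPath s₁) (P.toPolygon.boundaryPath s₃))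
    (γ' : Path (P.toPolygon.boundaryPath s₂) (P.toPolygon.boundaryPath s₄))
    (hγ : range γ ⊆ P.region) (hγ' : range γ' ⊆ P.region) : ∃ z ∈ range γ, z ∈ range γ' := by
  by_contra! hdisj
  have hk : (0 : ℝ) < k := period_pos
  have hper := P.toPolygon.boundaryPath_add_period
  have hs1 : P.toPolygon.boundaryPath s₁ ∈ range γ := ⟨0, γ.source⟩
  have hs3 : P.toPolygon.boundaryPath s₃ ∈ range γ := ⟨1, γ.target⟩
  have hs2 : P.toPolygon.boundaryPath s₂ ∈ range γ' := ⟨0, γ'.source⟩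
  have hs4 : P.toPolygon.boundaryPath s₄ ∈ range γ' := ⟨1, γ'.target⟩
  have h12 : s₁ < s₂ := h₁₂.lt_of_ne fun h => hdisj (P.toPolygon.boundaryPath s₁) hs1 (by
    rw [congrArg P.toPolygon.boundaryPath h]; exact hs2)
  have h23 : s₂ < s₃ := h₂₃.lt_of_ne fun h => hdisj (P.toPolygon.boundaryPath s₃) hs3 (by
    rw [← congrArg P.toPolygon.boundaryPath h]; exact hs2)
  have h34 : s₃ < s₄ := h₃₄.lt_of_ne fun h => hdisj (P.toPolygon.boundaryPath s₃) hs3 (by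
    rw [congrArg P.toPolygon.boundaryPath h]; exact hs4)
  have h41 : s₄ < s₁ + k := h₄₁.lt_of_ne fun h => hdisj _ hs1 (⟨1, by
    rw [γ'.target, h, hper]⟩)
  -- Close γ by each of the two complementary boundary arcs between its ends.
  set L₁ : Path (P.toPolygon.boundaryPath s₁) (P.toPolygon.boundaryPath s₁) := γ.trans ((P.arc s₃ (s₁ + k)).cast rfl (hper s₁).symm) with hL₁
  set L₂ : Path (P.toPolygon.boundaryPath s₁) (P.toPolygon.boundaryPath s₁) := γ.trans (P.arc s₃ s₁) with hL₂
  have hr₁ : range L₁ = range γ ∪ P.toPolygon.boundaryPath '' Icc s₃ (s₁ + k) := by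
    rw [hL₁, Path.trans_range, Path.cast_coe, range_arc, uIcc_of_le (by linarith)]
  have hr₂ : range L₂ = range γ ∪ P.toPolygon.boundaryPath '' Icc s₁ s₃ := by
    rw [hL₂, Path.trans_range, range_arc, uIcc_of_ge (by linarith)]
  have hJ : ∀ S : Set ℝ, P.toPolygon.boundaryPath '' S ⊆ P.region := by
    rintro S _ ⟨u, -, rfl⟩; exact P.bdry_subset_region (P.boundaryPath_mem u)
  have hL₁r : range L₁ ⊆ P.region := hr₁ ▸ union_subset hγ (hJ _)
  have hL₂r : range L₂ ⊆ P.region := hr₂ ▸ union_subset hγ (hJ _)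
  -- The two windings differ by that of the full boundary, which is nonzero around interior points.
  have hne : ∀ p ∈ P.region, p ∉ range L₁ → p ∉ range L₂ → L₁.logInc p ≠ L₂.logInc p := by
    intro p hp hp₁ hp₂
    have hpJ : p ∉ P.bdry := by
      intro h
      obtain ⟨t, ht, rfl⟩ := P.exists_boundaryPath_eq h s₁
      rw [hr₁] at hp₁
      rw [hr₂] at hp₂
      rcases le_total t s₃ with h | h
      · exact hp₂ (Or.inr ⟨t, ⟨ht.1, h⟩, rfl⟩)
      · exact hp₁ (Or.inr ⟨t, ⟨h, ht.2.le⟩, rfl⟩)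
    have hJ' : ∀ s t, p ∉ range (P.arc s t) := by
      rintro s t ⟨u, rfl⟩; exact hpJ (P.boundaryPath_mem _)
    have hpγ : p ∉ range γ := fun h => hp₂ (hr₂ ▸ Or.inl h)
    obtain ⟨θ, hθ, hθp⟩ := P.exists_log_boundaryPath hpJ
    have h₁ : L₁.logInc p = γ.logInc p + (P.arc s₃ (s₁ + k)).logInc p :=
      Path.logInc_trans γ _ hpγ (hJ' s₃ (s₁ + k))
    have h₂ : L₂.logInc p = γ.logInc p + (P.arc s₃ s₁).logInc p :=
      Path.logInc_trans γ _ hpγ (hJ' s₃ s₁)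
    rw [h₁, h₂, P.logInc_arc _ _ hθ hθp, P.logInc_arc _ _ hθ hθp]
    intro h
    exact P.log_add_period_ne hpJ hp hθ hθp s₁ (by linear_combination h)
  -- Times at which γ' is off a loop that does not wind around it. A and C are open and disjoint. At
  -- a time when γ' is on L₁ it is on the boundary and off L₂, hence in C; so A is closed too. But
  -- γ' starts in A and ends in C.
  set A : Set I := {t | γ' t ∉ range L₁ ∧ L₁.logInc (γ' t) = 0} with hA
  set C : Set I := {t | γ' t ∉ range L₂ ∧ L₂.logInc (γ' t) = 0} with hC
  have hAo : IsOpen A := isOpen_iff_mem_nhds.mpr fun t ht => by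
    filter_upwards [γ'.continuous.continuousAt.eventually (L₁.eventually_logInc_eq ht.1)] with u hu
    exact ⟨hu.1, hu.2.trans ht.2⟩
  have hCo : IsOpen C := isOpen_iff_mem_nhds.mpr fun t ht => by
    filter_upwards [γ'.continuous.continuousAt.eventually (L₂.eventually_logInc_eq ht.1)] with u hu
    exact ⟨hu.1, hu.2.trans ht.2⟩
  have hAC : Disjoint A C := disjoint_left.mpr fun t h h' =>
    hne _ (hγ' (mem_range_self t)) h.1 h'.1 (h.2.trans h'.2.symm)
  have hnotγ : ∀ t, γ' t ∉ range γ := fun t h => hdisj _ h (mem_range_self t)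
  have hcov : ∀ t, γ' t ∈ range L₁ → t ∈ C := by
    intro t ht
    rw [hr₁] at ht
    obtain ⟨u, hu, hut⟩ := ht.resolve_left (hnotγ t)
    have hnot : γ' t ∉ range L₂ := by
      rw [hr₂]
      rintro (h | ⟨v, hv, hvt⟩)
      · exact hnotγ t h
      have huv : P.toPolygon.boundaryPath u = P.toPolygon.boundaryPath v := hut.trans hvt.symm
      rcases (show u - v ≤ k by linarith [hu.2, hv.1]).lt_or_eq with h | h
      · have := P.eq_of_boundaryPath_eq huv (by rw [abs_lt]; constructor <;> linarith [hu.1, hv.2])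
        have h3 : v = s₃ := le_antisymm hv.2 (this ▸ hu.1)
        exact hnotγ t (hvt ▸ h3 ▸ hs3)
      · have h1 : v = s₁ := le_antisymm (by linarith [hu.2]) hv.1
        exact hnotγ t (hvt ▸ h1 ▸ hs1)
    exact ⟨hnot, P.logInc_eq_zero_of_mem_bdry L₂ hL₂r (hut ▸ P.boundaryPath_mem u) hnot⟩
  have hAcl : IsClosed A := by
    rw [← isOpen_compl_iff, isOpen_iff_mem_nhds]
    intro t ht
    by_cases h : γ' t ∈ range L₁
    · exact Filter.mem_of_superset (hCo.mem_nhds (hcov t h)) fun u hu hu' =>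
        disjoint_left.mp hAC hu' hu
    · have h0 : L₁.logInc (γ' t) ≠ 0 := fun h0 => ht ⟨h, h0⟩
      filter_upwards [γ'.continuous.continuousAt.eventually (L₁.eventually_logInc_eq h)] with u hu
      exact fun hu' => h0 (hu.2.symm.trans hu'.2)
  have hmem : ∀ s, P.toPolygon.boundaryPath s ∈ P.bdry := P.boundaryPath_mem
  have h0A : (0 : I) ∈ A := by
    have hnot : γ' 0 ∉ range L₁ := by
      rw [hr₁]
      rintro (h | ⟨u, hu, hu'⟩)
      · exact hnotγ 0 h
      · rw [γ'.source] at hu'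
        have := P.eq_of_boundaryPath_eq hu' (by rw [abs_lt]; constructor <;> linarith [hu.1, hu.2])
        linarith [hu.1]
    exact ⟨hnot, P.logInc_eq_zero_of_mem_bdry L₁ hL₁r (by rw [γ'.source]; exact hmem _) hnot⟩
  have h1C : (1 : I) ∈ C := by
    have hnot : γ' 1 ∉ range L₂ := by
      rw [hr₂]
      rintro (h | ⟨u, hu, hu'⟩)
      · exact hnotγ 1 h
      · rw [γ'.target] at hu'
        have := P.eq_of_boundaryPath_eq hu' (by rw [abs_lt]; constructor <;> linarith [hu.1, hu.2])
        linarith [hu.2]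
    exact ⟨hnot, P.logInc_eq_zero_of_mem_bdry L₂ hL₂r (by rw [γ'.target]; exact hmem _) hnot⟩
  have huniv : A = univ := IsClopen.eq_univ ⟨hAcl, hAo⟩ ⟨0, h0A⟩
  exact disjoint_left.mp hAC (huniv ▸ mem_univ (1 : I)) h1C

end SimplePolygon

/-! ### Chords of a polygon -/

/-- The condition on the quotient expresses that u and v are linearly independent over ℝ. -/
theorem toC_smul_add_ne {u v : Plane} (huv : (toC v / toC u).im ≠ 0) {x : ℝ} (hx : x ≠ 0) (y : ℝ) :
    x • v ≠ y • u := by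
  intro h
  have hu : toC u ≠ 0 := fun h0 => huv (by simp [h0])
  have h1 : (x : ℂ) * toC v = y * toC u := by simpa using congrArg toC h
  have h2 : toC v / toC u = ((y / x : ℝ) : ℂ) := by
    have hx' : (x : ℂ) ≠ 0 := by exact_mod_cast hx
    push_cast
    field_simp
    linear_combination h1
  exact huv (by rw [h2, Complex.ofReal_im])

theorem Complex.im_neg_one_mul_sub_div_add (y w : ℂ) (hy : y.im = 0) :
    (-1 * ((y - w) / (y + w))).im = 2 * y.re * w.im / Complex.normSq (y + w) := by
  rw [neg_one_mul, Complex.neg_im, Complex.div_im]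
  simp [hy]
  ring

/-- The expression is the mismatch between two branches of the logarithm of (1 - w)/(1 + w). Its
sign is opposite for w in the lower half-plane, so the mismatches at the two ends of a crossed
segment cannot cancel. -/
theorem Complex.im_log_sub_log_sub_log_neg {w : ℂ} (hw : 0 < w.im) :
    (Complex.log (1 - w) - Complex.log (1 + w) - Complex.log (-1 * ((1 - w) / (1 + w)))).im < 0 := by
  have h1 : (1 - w).arg < 0 := Complex.arg_neg_iff.mpr (by simpa using hw)
  have h2 : 0 ≤ (1 + w).arg := Complex.arg_nonneg_iff.mpr (by simpa using hw.le)
  have h3 : 0 ≤ (-1 * ((1 - w) / (1 + w))).arg := by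
    rw [Complex.arg_nonneg_iff, Complex.im_neg_one_mul_sub_div_add 1 w (by simp)]
    have := Complex.normSq_nonneg (1 + w)
    rw [Complex.one_re]
    positivity
  simp only [Complex.sub_im, Complex.log_im]
  linarith

theorem Complex.im_log_sub_log_sub_log_pos {w : ℂ} (hw : w.im < 0) :
    0 < (Complex.log (1 - w) - Complex.log (1 + w) - Complex.log (-1 * ((1 - w) / (1 + w)))).im := by
  have h1 : 0 ≤ (1 - w).arg := Complex.arg_nonneg_iff.mpr (by simpa using hw.le)
  have h2 : (1 + w).arg < 0 := Complex.arg_neg_iff.mpr (by simpa using hw)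
  have h3 : (-1 * ((1 - w) / (1 + w))).arg < 0 := by
    rw [Complex.arg_neg_iff, Complex.im_neg_one_mul_sub_div_add 1 w (by simp)]
    have h0 : 1 + w ≠ 0 := fun h => by simpa [hw.ne] using congrArg Complex.im h
    have := Complex.normSq_pos.mpr h0
    rw [Complex.one_re]
    exact div_neg_of_neg_of_pos (by linarith) this
  simp only [Complex.sub_im, Complex.log_im]
  linarith

theorem Plane.exists_smul_of_mem_segment {c u : Plane} {α β : ℝ} {z : Plane}
    (hz : z ∈ segment ℝ (c + α • u) (c + β • u)) : ∃ y : ℝ, z = c + y • u := by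
  obtain ⟨x, y, hx, hy, hxy, rfl⟩ := hz
  refine ⟨x * α + y * β, ?_⟩
  have hx' : x = 1 - y := by linarith
  rw [hx']
  module

/-- The logarithmic increment of a closed path jumps across a segment of the path. -/
theorem Path.logInc_jump {c u v : Plane} {α β : ℝ} (hα : α < 0) (hβ : 0 < β)
    (γ : Path (c + β • u) (c + α • u)) (huv : (toC v / toC u).im ≠ 0) (hc : c ∉ range γ) {ε : ℝ}
    (hε : 0 < ε)
    (h₁ : ∀ z ∈ range γ, toC (z - (c + ε • v)) / toC (z - c) ∈ Complex.slitPlane)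
    (h₂ : ∀ z ∈ range γ, toC (z - (c - ε • v)) / toC (z - c) ∈ Complex.slitPlane)
    (hp : c + ε • v ∉ range γ) (hq : c - ε • v ∉ range γ) :
    (γ.trans (Path.segment (c + α • u) (c + β • u))).logInc (c + ε • v) ≠
      (γ.trans (Path.segment (c + α • u) (c + β • u))).logInc (c - ε • v) := by
  have hu : toC u ≠ 0 := fun h0 => huv (by simp [h0])
  set κ := toC v / toC u with hκ
  have hv : toC v = κ * toC u := by rw [hκ, div_mul_cancel₀ _ hu]
  have hseg : ∀ x : ℝ, x ≠ 0 → c + x • v ∉ range (Path.segment (c + α • u) (c + β • u)) := by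
    intro x hx h
    rw [Path.range_segment] at h
    obtain ⟨y, hy⟩ := Plane.exists_smul_of_mem_segment h
    exact toC_smul_add_ne huv hx y (add_left_cancel hy)
  have hp' := hseg ε hε.ne'
  have hq' : c - ε • v ∉ range (Path.segment (c + α • u) (c + β • u)) := by
    simpa [sub_eq_add_neg] using hseg (-ε) (neg_ne_zero.mpr hε.ne')
  have hρ : ∀ y : ℝ, toC (c + y • u - (c + ε • v)) / toC (c + y • u - (c - ε • v)) =
      (y - ε * κ) / (y + ε * κ) := by
    intro y
    have e1 : toC (c + y • u - (c + ε • v)) = (y - ε * κ) * toC u := by simp [hv]; ring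
    have e2 : toC (c + y • u - (c - ε • v)) = (y + ε * κ) * toC u := by simp [hv]; ring
    rw [e1, e2, mul_div_mul_right _ _ hu]
  have hρ₁ : ∀ y : ℝ, y ≠ 0 → toC (c + y • u - (c + ε • v)) / toC (c + y • u - c) =
      1 - ε * κ / y := by
    intro y hy
    have hy' : (y : ℂ) ≠ 0 := by exact_mod_cast hy
    simp [hv]; field_simp
  have hρ₂ : ∀ y : ℝ, y ≠ 0 → toC (c + y • u - (c - ε • v)) / toC (c + y • u - c) =
      1 + ε * κ / y := by
    intro y hy
    have hy' : (y : ℂ) ≠ 0 := by exact_mod_cast hy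
    simp [hv]; field_simp
  have hρ' : ∀ y : ℝ, y ≠ 0 → toC (c + y • u - (c + ε • v)) / toC (c + y • u - (c - ε • v)) =
      (1 - ε * κ / y) / (1 + ε * κ / y) := by
    intro y hy
    have hy' : (y : ℂ) ≠ 0 := by exact_mod_cast hy
    rw [hρ]
    have e1 : (1 : ℂ) - ε * κ / y = (y - ε * κ) / y := by field_simp
    have e2 : (1 : ℂ) + ε * κ / y = (y + ε * κ) / y := by field_simp
    rw [e1, e2, div_div_div_cancel_right₀ hy']
  have hεκ : ((ε : ℂ) * κ).im ≠ 0 := by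
    rw [Complex.im_ofReal_mul]; exact mul_ne_zero hε.ne' huv
  -- At c the quotient is -1, on the branch cut; the factor -1 moves it off the cut along the whole
  -- segment.
  have hslit : ∀ z ∈ range (Path.segment (c + α • u) (c + β • u)),
      -1 * (toC (z - (c + ε • v)) / toC (z - (c - ε • v))) ∈ Complex.slitPlane := by
    intro z hz
    rw [Path.range_segment] at hz
    obtain ⟨y, rfl⟩ := Plane.exists_smul_of_mem_segment hz
    rw [hρ]
    rcases eq_or_ne y 0 with rfl | hy
    · have : (ε : ℂ) * κ ≠ 0 := fun h => hεκ (by rw [h, Complex.zero_im])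
      rw [Complex.ofReal_zero, zero_sub, zero_add, neg_div, div_self this]
      simp
    · right
      rw [Complex.im_neg_one_mul_sub_div_add _ _ (Complex.ofReal_im y)]
      have : (y : ℂ) + ε * κ ≠ 0 := fun h => hεκ (by simpa using congrArg Complex.im h)
      have := Complex.normSq_pos.mpr this
      rw [Complex.ofReal_re]
      positivity
  have i₁ := γ.logInc_eq_add_log hc 1 (by simpa only [one_mul] using h₁)
  have i₂ := γ.logInc_eq_add_log hc 1 (by simpa only [one_mul] using h₂)
  have i₃ := (Path.segment (c + α • u) (c + β • u)).logInc_eq_add_log hq' (-1) hslit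
  rw [hρ₁ _ hβ.ne', hρ₁ _ hα.ne] at i₁
  rw [hρ₂ _ hβ.ne', hρ₂ _ hα.ne] at i₂
  rw [hρ' _ hβ.ne', hρ' _ hα.ne] at i₃
  rw [Path.logInc_trans _ _ hp hp', Path.logInc_trans _ _ hq hq', i₁, i₂, i₃]
  simp only [one_mul]
  intro h
  have him : ∀ y : ℝ, (ε * κ / y : ℂ).im = ε * κ.im / y := fun y => by
    rw [Complex.div_ofReal_im, Complex.im_ofReal_mul]
  have key := congrArg Complex.im h
  simp only [Complex.add_im, Complex.sub_im] at key
  -- Equal windings would force equal branch mismatches at y = α and y = β, but α and β have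
  -- opposite signs, so εκ/α and εκ/β lie in opposite half-planes.
  rcases lt_or_gt_of_ne huv with hneg | hpos
  · have i1 := Complex.im_log_sub_log_sub_log_pos (w := ε * κ / β) (by
      rw [him]; exact div_neg_of_neg_of_pos (mul_neg_of_pos_of_neg hε hneg) hβ)
    have i2 := Complex.im_log_sub_log_sub_log_neg (w := ε * κ / α) (by
      rw [him]; exact div_pos_of_neg_of_neg (mul_neg_of_pos_of_neg hε hneg) hα)
    simp only [Complex.sub_im] at i1 i2
    linarith
  · have i1 := Complex.im_log_sub_log_sub_log_neg (w := ε * κ / β) (by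
      rw [him]; positivity)
    have i2 := Complex.im_log_sub_log_sub_log_pos (w := ε * κ / α) (by
      rw [him]; exact div_neg_of_pos_of_neg (mul_pos hε hpos) hα)
    simp only [Complex.sub_im] at i1 i2
    linarith

namespace SimplePolygon

variable {k : ℕ} [NeZero k] (P : SimplePolygon k)

/-- A ray that starts on a closed path and enters a part of the plane that the path winds around
meets the path again, and stays in the polygon until then. -/
theorem exists_ray_hit {c u v : Plane} {α β : ℝ} (hα : α < 0) (hβ : 0 < β)
    (hseg : segment ℝ (c + α • u) (c + β • u) ⊆ P.region)
    (γ : Path (c + β • u) (c + α • u)) (hγ : range γ ⊆ P.region)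
    (huv : (toC v / toC u).im ≠ 0) {ε : ℝ} (hε : 0 < ε)
    (hfree : ∀ x ∈ Icc 0 ε, c + x • v ∉ range γ)
    (hne : (γ.trans (Path.segment (c + α • u) (c + β • u))).logInc (c + ε • v) ≠ 0) :
    ∃ s : ℝ, c + s • v ∈ range γ ∧ ∀ x ∈ uIcc 0 s, c + x • v ∈ P.region := by
  set L := γ.trans (Path.segment (c + α • u) (c + β • u)) with hL
  have hLr : range L = range γ ∪ segment ℝ (c + α • u) (c + β • u) := by
    rw [hL, Path.trans_range, Path.range_segment]
  have hns : ∀ x : ℝ, x ≠ 0 → c + x • v ∉ segment ℝ (c + α • u) (c + β • u) := by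
    intro x hx h
    obtain ⟨y, hy⟩ := Plane.exists_smul_of_mem_segment h
    exact toC_smul_add_ne huv hx y (add_left_cancel hy)
  have hcont : Continuous fun x : ℝ => c + x • v := by fun_prop
  have hv : v ≠ 0 := by rintro rfl; simp at huv
  set T : Set ℝ := {x | ε ≤ x ∧ c + x • v ∈ range γ} with hT
  have hTc : IsClosed T :=
    isClosed_Ici.inter ((isCompact_range γ.continuous).isClosed.preimage hcont)
  -- Otherwise the whole open ray avoids L; it is connected and unbounded, so the winding would
  -- vanish on it.
  have hTn : T.Nonempty := by
    by_contra hTe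
    rw [not_nonempty_iff_eq_empty] at hTe
    refine hne (L.logInc_eq_zero_of_not_isBounded
      (S := (fun x : ℝ => c + x • v) '' Ioi 0) (isPreconnected_Ioi.image _ hcont.continuousOn)
      ?_ ?_ ⟨ε, hε, rfl⟩)
    · rw [disjoint_left, hLr]
      rintro _ ⟨x, hx, rfl⟩ (h | h)
      · rcases le_total x ε with hxε | hxε
        · exact hfree x ⟨le_of_lt hx, hxε⟩ h
        · exact (hTe ▸ (⟨hxε, h⟩ : x ∈ T) : x ∈ (∅ : Set ℝ))
      · exact hns x (ne_of_gt hx) h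
    · intro hb
      obtain ⟨M, hM⟩ := hb.exists_norm_le
      have hv' : 0 < ‖v‖ := norm_pos_iff.mpr hv
      have hMc := hM (c + ((|M| + ‖c‖ + 1) / ‖v‖) • v) ⟨_, by
        change 0 < (|M| + ‖c‖ + 1) / ‖v‖
        positivity, rfl⟩
      have h1 : ‖((|M| + ‖c‖ + 1) / ‖v‖) • v‖ = |M| + ‖c‖ + 1 := by
        rw [norm_smul, Real.norm_of_nonneg (by positivity), div_mul_cancel₀ _ hv'.ne']
      have h2 := norm_sub_le (c + ((|M| + ‖c‖ + 1) / ‖v‖) • v) c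
      rw [add_sub_cancel_left, h1] at h2
      linarith [le_abs_self M]
  have hTb : BddBelow T := ⟨ε, fun x hx => hx.1⟩
  obtain ⟨hsε, hs⟩ := hTc.csInf_mem hTn hTb
  set s := sInf T
  have hs0 : 0 < s := hε.trans_le hsε
  refine ⟨s, hs, fun x hx => ?_⟩
  rw [uIcc_of_le hs0.le] at hx
  have hfree' : ∀ y ∈ Ioo 0 s, c + y • v ∉ range γ := by
    intro y hy h
    rcases le_total y ε with hyε | hyε
    · exact hfree y ⟨hy.1.le, hyε⟩ h
    · exact (csInf_le hTb (⟨hyε, h⟩ : y ∈ T)).not_gt hy.2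
  have hεs : ε < s := hsε.lt_of_ne fun h => hfree ε ⟨hε.le, le_rfl⟩ (h ▸ hs)
  rcases hx.1.eq_or_lt with h | h0
  -- The point c is the convex combination of the ends of the segment with weights proportional to β
  -- and -α.
  · rw [← h, zero_smul, add_zero]
    have h1 : 0 < β - α := by linarith
    refine hseg ⟨β / (β - α), -α / (β - α), by positivity,
      div_nonneg (by linarith) h1.le, by field_simp; ring, ?_⟩
    have h2 : β / (β - α) = 1 - -α / (β - α) := by field_simp; ring
    have h3 : -α / (β - α) * β = - ((1 - -α / (β - α)) * α) := by field_simp; ring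
    rw [h2, smul_add, smul_add, smul_smul, smul_smul, h3]
    module
  rcases hx.2.eq_or_lt with h | hxs
  · rw [h]; exact hγ hs
  -- Before the first hit s the ray avoids L, so the winding stays nonzero there, which is
  -- impossible outside the polygon.
  by_contra hout
  refine hne ?_
  rw [L.logInc_eq_of_isPreconnected (S := (fun x : ℝ => c + x • v) '' Ioo 0 s)
    (isPreconnected_Ioo.image _ hcont.continuousOn) ?_ (q := c + x • v) ⟨ε, ⟨hε, hεs⟩, rfl⟩
    ⟨x, ⟨h0, hxs⟩, rfl⟩]
  · exact P.logInc_eq_zero_of_notMem_region L (hLr ▸ union_subset hγ hseg) hout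
  · rw [disjoint_left, hLr]
    rintro _ ⟨y, hy, rfl⟩ (h | h)
    · exact hfree' y hy h
    · exact hns y (ne_of_gt hy.1) h

/-- From an inner point of a segment whose ends are joined by a path in the polygon, one can move
in the polygon in a given transversal direction or its opposite until one meets the path. -/
theorem exists_chord {c u v : Plane} {α β : ℝ} (hα : α < 0) (hβ : 0 < β)
    (hseg : segment ℝ (c + α • u) (c + β • u) ⊆ P.region)
    (γ : Path (c + β • u) (c + α • u)) (hγ : range γ ⊆ P.region)
    (huv : (toC v / toC u).im ≠ 0) :
    ∃ s : ℝ, c + s • v ∈ range γ ∧ ∀ x ∈ uIcc 0 s, c + x • v ∈ P.region := by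
  by_cases hc : c ∈ range γ
  · exact ⟨0, by simpa using hc, by simpa using hγ hc⟩
  have hev : ∀ᶠ q in 𝓝 c, q ∉ range γ ∧
      ∀ z ∈ range γ, toC (z - q) / toC (z - c) ∈ Complex.slitPlane :=
    ((isCompact_range γ.continuous).isClosed.isOpen_compl.eventually_mem hc).and
      (γ.eventually_div_mem_slitPlane hc)
  have hcont : Filter.Tendsto (fun x : ℝ => c + x • v) (𝓝 0) (𝓝 c) := by
    have h : ContinuousAt (fun x : ℝ => c + x • v) 0 := by fun_prop
    simpa [ContinuousAt] using h
  have hev' := hcont.eventually hev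
  obtain ⟨δ, hδ, hball⟩ := Metric.eventually_nhds_iff.mp hev'
  have hx : ∀ x : ℝ, |x| ≤ δ / 2 → c + x • v ∉ range γ ∧
      ∀ z ∈ range γ, toC (z - (c + x • v)) / toC (z - c) ∈ Complex.slitPlane := fun x hx =>
    hball (show dist x 0 < δ by rw [Real.dist_eq, sub_zero]; linarith)
  have hδ2 : 0 < δ / 2 := by positivity
  have hneg : ∀ x : ℝ, c + x • -v = c + (-x) • v := fun x => by module
  have hp := hx (δ / 2) (by rw [abs_of_pos hδ2])
  have hq : c - (δ / 2) • v ∉ range γ ∧ ∀ z ∈ range γ,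
      toC (z - (c - (δ / 2) • v)) / toC (z - c) ∈ Complex.slitPlane := by
    have := hx (-(δ / 2)) (by rw [abs_neg, abs_of_pos hδ2])
    rwa [neg_smul, ← sub_eq_add_neg] at this
  -- The windings on the two sides of the segment differ, so one is nonzero; that side gives the
  -- direction of the ray.
  have hjump := Path.logInc_jump hα hβ γ huv hc hδ2 hp.2 hq.2 hp.1 hq.1
  by_cases h0 : (γ.trans (Path.segment (c + α • u) (c + β • u))).logInc (c + (δ / 2) • v) = 0
  · rw [h0] at hjump
    obtain ⟨s, hs, hs'⟩ := P.exists_ray_hit (v := -v) hα hβ hseg γ hγ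
      (by rw [map_neg, neg_div, Complex.neg_im]; exact neg_ne_zero.mpr huv) hδ2
      (fun x hx' => by
        rw [hneg]; exact (hx (-x) (by rw [abs_neg, abs_of_nonneg hx'.1]; exact hx'.2)).1)
      (by rw [hneg, neg_smul, ← sub_eq_add_neg]; exact hjump.symm)
    refine ⟨-s, hneg s ▸ hs, fun x hx' => ?_⟩
    have := hs' (-x) (by
      rw [← neg_zero, ← image_neg_uIcc] at hx'
      obtain ⟨y, hy, rfl⟩ := hx'
      simpa using hy)
    rwa [hneg, neg_neg] at this
  · exact P.exists_ray_hit hα hβ hseg γ hγ huv hδ2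
      (fun x hx' => (hx x (by rw [abs_of_nonneg hx'.1]; exact hx'.2)).1) h0

end SimplePolygon

/-! ### The geodesic distance -/

namespace SimplePolygon

variable {k : ℕ} [NeZero k] (P : SimplePolygon k)

theorem geodist_le {p q : Plane} (γ : Path p q) (hγ : ∀ t, γ t ∈ P.region) :
    P.geodist p q ≤ eVariationOn γ univ := iInf₂_le γ hγ

/-- Lets arguments about two geodesics run on arbitrary paths, without assuming that the infima are
attained. -/
theorem le_geodist_add {p q p' q' : Plane} {C : ℝ≥0∞}
    (h : ∀ (γ : Path p q) (γ' : Path p' q'), (∀ t, γ t ∈ P.region) → (∀ t, γ' t ∈ P.region) →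
      C ≤ eVariationOn γ univ + eVariationOn γ' univ) :
    C ≤ P.geodist p q + P.geodist p' q' := by
  simp only [geodist, ENNReal.iInf_add, ENNReal.add_iInf]
  exact le_iInf₂ fun γ hγ => le_iInf₂ fun γ' hγ' => h _ _ ‹_› ‹_›

theorem exists_path_lt {p q : Plane} {C : ℝ≥0∞} (h : P.geodist p q < C) :
    ∃ γ : Path p q, (∀ t, γ t ∈ P.region) ∧ eVariationOn γ univ < C := by
  simpa only [geodist, iInf_lt_iff, exists_prop] using h

theorem edist_le_geodist (p q : Plane) : edist p q ≤ P.geodist p q :=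
  le_iInf₂ fun γ _ => by
    simpa using eVariationOn.edist_le γ (mem_univ (0 : I)) (mem_univ 1)

theorem geodist_comm (p q : Plane) : P.geodist p q = P.geodist q p := by
  have h : ∀ p q, P.geodist p q ≤ P.geodist q p := fun p q =>
    le_iInf₂ fun γ hγ => (P.geodist_le γ.symm fun t => hγ _).trans
      (eVariationOn.comp_le_of_antitoneOn γ σ
        (fun _ _ _ _ h => unitInterval.symm_le_symm.mpr h) (mapsTo_univ _ _))
  exact le_antisymm (h p q) (h q p)

theorem _root_.Path.eVariationOn_trans_le {p q r : Plane} (γ : Path p q) (γ' : Path q r) :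
    eVariationOn (γ.trans γ') univ ≤ eVariationOn γ univ + eVariationOn γ' univ := by
  set m : I := ⟨1 / 2, by norm_num, by norm_num⟩
  have hu : (univ : Set I) = Iic m ∪ Ici m := by simp
  conv_lhs => rw [hu]
  rw [eVariationOn.union (γ.trans γ') isGreatest_Iic isLeast_Ici]
  refine add_le_add ?_ ?_
  · rw [eVariationOn.congr (g := γ ∘ fun t : I => projIcc 0 1 zero_le_one (2 * (t : ℝ))) ?_]
    · exact eVariationOn.comp_le_of_monotoneOn γ _
        (fun s _ t _ h => monotone_projIcc _ (by have : (s : ℝ) ≤ t := h; linarith)) (mapsTo_univ _ _)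
    · intro t ht
      have ht' : (t : ℝ) ≤ 1 / 2 := ht
      rw [Path.trans_apply, dif_pos ht', Function.comp_apply, projIcc_of_mem]
  · rw [eVariationOn.congr (g := γ' ∘ fun t : I => projIcc 0 1 zero_le_one (2 * (t : ℝ) - 1)) ?_]
    · exact eVariationOn.comp_le_of_monotoneOn γ' _
        (fun s _ t _ h => monotone_projIcc _ (by have : (s : ℝ) ≤ t := h; linarith)) (mapsTo_univ _ _)
    · intro t ht
      have ht' : 1 / 2 ≤ (t : ℝ) := ht
      have ht1 := t.2.2
      rw [Function.comp_apply, projIcc_of_mem zero_le_one (x := 2 * (t : ℝ) - 1)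
        ⟨by linarith, by linarith⟩]
      rcases ht'.eq_or_lt with h | h
      · have h1 : t = m := Subtype.ext h.symm
        have h0 : (⟨2 * (t : ℝ) - 1, by linarith, by linarith⟩ : I) = 0 := by
          ext; simp [← h]
        rw [h0, γ'.source, h1, Path.trans_apply, dif_pos le_rfl]
        have h2 : (⟨2 * (m : ℝ), by norm_num [m], by norm_num [m]⟩ : I) = 1 := by
          ext; norm_num [m]
        rw [h2, γ.target]
      · rw [Path.trans_apply, dif_neg (not_le.mpr h)]

theorem geodist_triangle (p q r : Plane) :
    P.geodist p r ≤ P.geodist p q + P.geodist q r :=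
  P.le_geodist_add fun γ γ' hγ hγ' => (P.geodist_le (γ.trans γ') fun t => by
    have : (γ.trans γ') t ∈ range γ ∪ range γ' := γ.trans_range γ' ▸ mem_range_self t
    rcases this with ⟨u, hu⟩ | ⟨u, hu⟩
    · rw [← hu]; exact hγ u
    · rw [← hu]; exact hγ' u).trans (γ.eVariationOn_trans_le γ')

/-- A path in the polygon through `z` is at least as long as the two geodesics via `z`. -/
theorem geodist_add_geodist_le {p q z : Plane} (γ : Path p q) (hγ : ∀ t, γ t ∈ P.region)
    (hz : z ∈ range γ) : P.geodist p z + P.geodist z q ≤ eVariationOn γ univ := by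
  obtain ⟨t, rfl⟩ := hz
  have hu : (univ : Set I) = Iic t ∪ Ici t := by simp
  conv_rhs => rw [hu]
  rw [eVariationOn.union γ isGreatest_Iic isLeast_Ici]
  have hmono : ∀ a b : I, a ≤ b → MonotoneOn (Icc.convexComb a b) univ := by
    intro a b hab x _ y _ hxy
    have h1 : (a : ℝ) ≤ b := hab
    have h2 : (x : ℝ) ≤ y := hxy
    refine Subtype.coe_le_coe.mp ?_
    simp only [Icc.coe_convexComb]
    nlinarith
  have hmem : ∀ a b x : I, a ≤ b → Icc.convexComb a b x ∈ Icc a b := by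
    intro a b x hab
    have h := hmono a b hab
    have h0 := h (mem_univ 0) (mem_univ x) x.2.1
    have h1 := h (mem_univ x) (mem_univ 1) x.2.2
    rw [Icc.convexComb_zero] at h0
    rw [Icc.convexComb_one] at h1
    exact ⟨h0, h1⟩
  refine add_le_add ?_ ?_
  · have := P.geodist_le (γ.subpath 0 t) fun s => hγ _
    exact (congrArg (P.geodist · (γ t)) γ.source.symm).trans_le <| this.trans (eVariationOn.comp_le_of_monotoneOn γ _ (hmono 0 t t.2.1)
      fun x _ => (hmem 0 t x t.2.1).2)
  · have := P.geodist_le (γ.subpath t 1) fun s => hγ _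
    exact (congrArg (P.geodist (γ t)) γ.target.symm).trans_le <| this.trans (eVariationOn.comp_le_of_monotoneOn γ _ (hmono t 1 t.2.2)
      fun x _ => (hmem t 1 x t.2.2).1)

theorem geodist_le_edist {p q : Plane} (h : segment ℝ p q ⊆ P.region) :
    P.geodist p q ≤ edist p q := by
  refine (P.geodist_le (Path.segment p q) fun t => h (Path.range_segment p q ▸ mem_range_self t)).trans ?_
  have h1 : LipschitzWith (nndist p q) (AffineMap.lineMap p q : ℝ → Plane) :=
    lipschitzWith_lineMap p q
  have h2 := (h1.lipschitzOnWith (s := univ)).comp_eVariationOn_le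
    (g := fun t : I => (t : ℝ)) (s := univ) (mapsTo_univ _ _)
  have h3 : eVariationOn (fun t : I => (t : ℝ)) univ ≤ 1 := by
    have := MonotoneOn.eVariationOn_eq (f := fun t : I => (t : ℝ)) (s := univ) (a := 0) (b := 1)
      (fun _ _ _ _ h => h) (mem_univ _) (mem_univ _)
    have hu : (univ : Set I) ∩ Icc 0 1 = univ := by
      rw [univ_inter]
      exact eq_univ_of_forall fun t => ⟨t.2.1, t.2.2⟩
    rw [hu] at this
    simpa using this.le
  calc eVariationOn (Path.segment p q) univ
      = eVariationOn ((AffineMap.lineMap p q : ℝ → Plane) ∘ fun t : I => (t : ℝ)) univ := rfl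
    _ ≤ nndist p q * 1 := h2.trans (by gcongr)
    _ = edist p q := by rw [mul_one, edist_nndist]

/-- The vertical coordinate contributes at least |s| - |t||u 1| and the horizontal one |t||u 0|. For
u flatter than the diagonal this is a gain over |s|. -/
theorem Plane.add_le_norm_smul_add_smul_I (u : Plane) (s t : ℝ) :
    |s| + |t| * (|u 0| - |u 1|) ≤ ‖t • u + s • toC.symm Complex.I‖ := by
  have h0 : (toC.symm Complex.I) 0 = 0 := by rw [← toC_re]; simp
  have h1 : (toC.symm Complex.I) 1 = 1 := by rw [← toC_im]; simp
  rw [Plane.norm_eq]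
  simp only [PiLp.add_apply, PiLp.smul_apply, smul_eq_mul, h0, h1, mul_zero, add_zero, mul_one,
    abs_mul]
  have := abs_sub_abs_le_abs_sub s (-(t * u 1))
  rw [abs_neg, abs_mul, sub_neg_eq_add, add_comm s] at this
  nlinarith

theorem Plane.add_le_norm_smul_add_smul_one (u : Plane) (s t : ℝ) :
    |s| + |t| * (|u 1| - |u 0|) ≤ ‖t • u + s • toC.symm 1‖ := by
  have h0 : (toC.symm 1) 0 = 1 := by rw [← toC_re]; simp
  have h1 : (toC.symm 1) 1 = 0 := by rw [← toC_im]; simp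
  rw [Plane.norm_eq]
  simp only [PiLp.add_apply, PiLp.smul_apply, smul_eq_mul, h0, h1, mul_zero, add_zero, mul_one,
    abs_mul]
  have := abs_sub_abs_le_abs_sub s (-(t * u 0))
  rw [abs_neg, abs_mul, sub_neg_eq_add, add_comm s] at this
  nlinarith

/-- For every vector that is not diagonal there is a transversal direction in which one moves away
from a line in the direction of that vector faster than the `L₁`-distance to its points grows. -/
theorem Plane.exists_transversal {u : Plane} (hu : |u 1| ≠ |u 0|) :
    ∃ (v : Plane) (δ : ℝ), 0 < δ ∧ (toC v / toC u).im ≠ 0 ∧ ‖v‖ = 1 ∧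
      ∀ s t : ℝ, |s| + |t| * δ ≤ ‖t • u + s • v‖ := by
  rcases lt_or_gt_of_ne hu with h | h
  · refine ⟨toC.symm Complex.I, |u 0| - |u 1|, by linarith, ?_, ?_,
      Plane.add_le_norm_smul_add_smul_I u⟩
    · have h0 : u 0 ≠ 0 := fun h0 => by simp [h0] at h; linarith [abs_nonneg (u 1)]
      have h1 : toC u ≠ 0 := fun h1 => h0 (by rw [← toC_re, h1, Complex.zero_re])
      have h2 := Complex.normSq_pos.mpr h1
      simp [Complex.div_im, toC_re, h0, h2.ne']
    · rw [Plane.norm_eq, ← toC_re, ← toC_im]; simp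
  · refine ⟨toC.symm 1, |u 1| - |u 0|, by linarith, ?_, ?_,
      Plane.add_le_norm_smul_add_smul_one u⟩
    · have h0 : u 1 ≠ 0 := fun h0 => by simp [h0] at h; linarith [abs_nonneg (u 0)]
      have h1 : toC u ≠ 0 := fun h1 => h0 (by rw [← toC_im, h1, Complex.zero_im])
      have h2 := Complex.normSq_pos.mpr h1
      simp [toC_im, h0, h2.ne']
    · rw [Plane.norm_eq, ← toC_re, ← toC_im]; simp

/-- The geodesic distance to a fixed point is strictly quasiconvex on segments in the polygon
that are not diagonal. -/
theorem geodist_lt_max {r a b c : Plane} (hab : segment ℝ a b ⊆ P.region)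
    (hc : c ∈ openSegment ℝ a b) (hslope : |b 1 - a 1| ≠ |b 0 - a 0|)
    (ha : P.geodist r a ≠ ⊤) (hb : P.geodist r b ≠ ⊤) :
    P.geodist r c < max (P.geodist r a) (P.geodist r b) := by
  obtain ⟨x, y, hx, hy, hxy, hxyc⟩ := hc
  obtain ⟨v, δ, hδ, huv, hv, hnorm⟩ := Plane.exists_transversal (u := b - a)
    (by simpa using hslope)
  have hx' : x = 1 - y := by linarith
  have hca : a = c + (-y) • (b - a) := by rw [← hxyc, hx']; module
  have hcb : b = c + x • (b - a) := by rw [← hxyc, hx']; module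
  set η : ℝ := min x y * δ with hη
  have hη0 : 0 < η := mul_pos (lt_min hx hy) hδ
  -- Here c + s • v is where the chord from c meets a path from r to the end e. The detour from
  -- there to c costs |s|, whereas going on to e costs at least |s| + |t| * δ; the saving is at
  -- least η.
  have key : ∀ e : Plane, P.geodist r e ≠ ⊤ → ∀ s t : ℝ, e = c + (-t) • (b - a) → min x y ≤ |t| →
      (∀ z ∈ uIcc 0 s, c + z • v ∈ P.region) → ∀ γ : Path r e, (∀ t, γ t ∈ P.region) →
      c + s • v ∈ range γ → P.geodist r c + ENNReal.ofReal η ≤ eVariationOn γ univ := by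
    intro e _ s t he ht hs γ hγ hmem
    have hseg : segment ℝ (c + s • v) c ⊆ P.region := by
      rintro _ ⟨x', y', hx', hy', hxy', rfl⟩
      have h1 : x' • (c + s • v) + y' • c = c + (x' * s) • v := by
        rw [← eq_sub_iff_add_eq'] at hxy'
        rw [hxy']; module
      rw [h1]
      refine hs _ ?_
      rcases le_total 0 s with h | h
      · rw [uIcc_of_le h]; constructor <;> nlinarith
      · rw [uIcc_of_ge h]; constructor <;> nlinarith
    have hd : edist (c + s • v) c + ENNReal.ofReal η ≤ edist (c + s • v) e := by
      have h1 : dist (c + s • v) c = |s| := by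
        rw [dist_eq_norm, add_sub_cancel_left, norm_smul, hv, mul_one, Real.norm_eq_abs]
      have h2 : dist (c + s • v) e = ‖t • (b - a) + s • v‖ := by
        rw [dist_eq_norm, he]; congr 1; module
      rw [edist_dist, edist_dist, ← ENNReal.ofReal_add dist_nonneg hη0.le, h1, h2]
      refine ENNReal.ofReal_le_ofReal (le_trans ?_ (hnorm s t))
      rw [hη]; gcongr
    calc P.geodist r c + ENNReal.ofReal η
        ≤ P.geodist r (c + s • v) + edist (c + s • v) c + ENNReal.ofReal η := by
          gcongr
          exact (P.geodist_triangle _ _ _).trans (by gcongr; exact P.geodist_le_edist hseg)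
      _ ≤ P.geodist r (c + s • v) + P.geodist (c + s • v) e := by
          rw [add_assoc]
          gcongr
          exact hd.trans (P.edist_le_geodist _ _)
      _ ≤ eVariationOn γ univ := P.geodist_add_geodist_le γ hγ hmem
  -- Paths within η of optimal suffice, since the saving η absorbs the error.
  have hη0' : ENNReal.ofReal η ≠ 0 := by simpa using hη0
  obtain ⟨γa, hγa, hla⟩ := P.exists_path_lt (ENNReal.lt_add_right ha hη0')
  obtain ⟨γb, hγb, hlb⟩ := P.exists_path_lt (ENNReal.lt_add_right hb hη0')
  have hγ : range (γb.symm.trans γa) ⊆ P.region := by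
    rw [Path.trans_range, Path.symm_range]
    exact union_subset (range_subset_iff.mpr hγb) (range_subset_iff.mpr hγa)
  -- The chord meets the path from b via r to a, hence one of its two halves.
  obtain ⟨s, hs, hs'⟩ := P.exists_chord (c := c) (u := b - a) (v := v) (α := -y) (β := x)
    (by linarith) hx (by rwa [← hca, ← hcb])
    ((γb.symm.trans γa).cast hcb.symm hca.symm) hγ huv
  have hmax : ∀ d : ℝ≥0∞, P.geodist r c + ENNReal.ofReal η < d + ENNReal.ofReal η →
      P.geodist r c < d := fun d hd => lt_of_add_lt_add_right hd
  rw [Path.cast_coe, Path.trans_range, Path.symm_range] at hs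
  rcases hs with hs | hs
  · exact lt_max_of_lt_right (hmax _ ((key b hb s (-x) (by rw [neg_neg]; exact hcb)
      (by rw [abs_neg, abs_of_pos hx]; exact min_le_left _ _) hs' γb hγb hs).trans_lt hlb))
  · exact lt_max_of_lt_left (hmax _ ((key a ha s y hca
      (by rw [abs_of_pos hy]; exact min_le_right _ _) hs' γa hγa hs).trans_lt hla))

/-- Exchanging the ends of two crossing geodesics does not increase the total length. -/
theorem geodist_add_geodist_le_of_interlacing {s₁ s₂ s₃ s₄ : ℝ} (h₁₂ : s₁ ≤ s₂) (h₂₃ : s₂ ≤ s₃)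
    (h₃₄ : s₃ ≤ s₄) (h₄₁ : s₄ ≤ s₁ + k) {a b c d : Plane} (ha : P.toPolygon.boundaryPath s₁ = a)
    (hb : P.toPolygon.boundaryPath s₂ = b) (hc : P.toPolygon.boundaryPath s₃ = c)
    (hd : P.toPolygon.boundaryPath s₄ = d) :
    P.geodist a d + P.geodist b c ≤ P.geodist a c + P.geodist b d := by
  subst ha hb hc hd
  refine P.le_geodist_add fun γ γ' hγ hγ' => ?_
  -- At the crossing point z the four pieces are recombined.
  obtain ⟨z, hz, hz'⟩ := P.exists_mem_range_of_interlacing h₁₂ h₂₃ h₃₄ h₄₁ γ γ'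
    (range_subset_iff.mpr hγ) (range_subset_iff.mpr hγ')
  refine le_trans ?_ (add_le_add (P.geodist_add_geodist_le γ hγ hz)
    (P.geodist_add_geodist_le γ' hγ' hz'))
  refine (add_le_add (P.geodist_triangle _ z _) (P.geodist_triangle _ z _)).trans_eq ?_
  ring

/-- The geodesic distance between boundary points is finite. -/
theorem geodist_ne_top {p q : Plane} (hp : p ∈ P.bdry) (hq : q ∈ P.bdry) :
    P.geodist p q ≠ ⊤ := by
  have hstep : ∀ (n : ℤ), ∀ t ∈ Icc (n : ℝ) (n + 1),
      P.geodist (P.toPolygon.boundaryPath n) (P.toPolygon.boundaryPath t) ≠ ⊤ := by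
    intro n t ht
    refine ne_top_of_le_ne_top (edist_ne_top _ _) (P.geodist_le_edist ?_)
    rw [segment_eq_image_lineMap]
    rintro _ ⟨x, hx, rfl⟩
    refine P.bdry_subset_region ?_
    have h := P.boundaryPath_mem (n + x * (t - n))
    rw [P.toPolygon.boundaryPath_eq_lineMap n
      ⟨by nlinarith [hx.1, ht.1], by nlinarith [hx.1, hx.2, ht.1, ht.2]⟩] at h
    rw [P.toPolygon.boundaryPath_eq_lineMap n ht,
      P.toPolygon.boundaryPath_eq_lineMap n ⟨le_rfl, by linarith⟩, sub_self,
      AffineMap.lineMap_apply_zero]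
    convert h using 1
    rw [AffineMap.lineMap_apply, AffineMap.lineMap_apply, AffineMap.lineMap_apply]
    simp only [vsub_eq_sub, vadd_eq_add, add_sub_cancel_left, add_sub_cancel_right, smul_smul]
  have hvert : ∀ n : ℕ, P.geodist (P.toPolygon.boundaryPath 0) (P.toPolygon.boundaryPath n) ≠ ⊤ := by
    intro n
    induction n with
    | zero => simpa using hstep 0 0 (by simp)
    | succ n ih =>
      refine ne_top_of_le_ne_top (ENNReal.add_ne_top.mpr ⟨ih, ?_⟩) (P.geodist_triangle _ _ _)
      simpa using hstep n (n + 1) (by simp)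
  have h0 : ∀ z ∈ P.bdry, P.geodist (P.toPolygon.boundaryPath 0) z ≠ ⊤ := by
    intro z hz
    obtain ⟨t, ht, rfl⟩ := P.exists_boundaryPath_eq hz 0
    refine ne_top_of_le_ne_top (ENNReal.add_ne_top.mpr ⟨hvert ⌊t⌋₊, ?_⟩) (P.geodist_triangle _ _ _)
    simpa using hstep ⌊t⌋₊ t ⟨by simpa using Nat.floor_le ht.1, by
      simpa using (Nat.lt_floor_add_one t).le⟩
  refine ne_top_of_le_ne_top (ENNReal.add_ne_top.mpr ⟨?_, h0 q hq⟩) (P.geodist_triangle _ _ _)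
  rw [geodist_comm]; exact h0 p hp

end SimplePolygon

/-! ### Monotone paths in the parameter square -/

/-- There is a path from `p` to `q` in `G` that is monotone in both coordinates. -/
def MonoReach (G : Set (ℝ × ℝ)) (p q : ℝ × ℝ) : Prop :=
  ∃ γ : Path p q, Monotone γ ∧ ∀ t, γ t ∈ G

namespace MonoReach

variable {G : Set (ℝ × ℝ)} {p q r : ℝ × ℝ}

theorem trans (h : MonoReach G p q) (h' : MonoReach G q r) : MonoReach G p r := by
  obtain ⟨γ, hγ, hG⟩ := h
  obtain ⟨γ', hγ', hG'⟩ := h'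
  refine ⟨γ.trans γ', fun s t hst => ?_, fun t => ?_⟩
  · have hst' : (s : ℝ) ≤ t := hst
    rw [Path.trans_apply, Path.trans_apply]
    split_ifs with h1 h2 h2
    · exact hγ (Subtype.mk_le_mk.mpr (by linarith))
    · exact (hγ (unitInterval.le_one' (t := _))).trans
        ((γ.target.trans γ'.source.symm).trans_le (hγ' unitInterval.nonneg'))
    · linarith
    · exact hγ' (Subtype.mk_le_mk.mpr (by linarith))
  · rw [Path.trans_apply]
    split_ifs
    exacts [hG _, hG' _]

theorem swap (h : MonoReach G p q) : MonoReach (Prod.swap ⁻¹' G) p.swap q.swap := by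
  obtain ⟨γ, hγ, hG⟩ := h
  exact ⟨γ.map continuous_swap, fun s t hst => Prod.swap_le_swap.mpr (hγ hst), fun t => by
    simpa using hG t⟩

theorem graph {m : ℝ → ℝ} (hm : Continuous m) (hmono : Monotone m) {a b : ℝ} (hab : a ≤ b)
    (h : ∀ x ∈ Icc a b, (x, m x) ∈ G) : MonoReach G (a, m a) (b, m b) := by
  have hl : Monotone (AffineMap.lineMap a b : ℝ → ℝ) := AffineMap.lineMap_mono hab
  have hc : Continuous (AffineMap.lineMap a b : ℝ → ℝ) := AffineMap.lineMap_continuous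
  refine ⟨⟨⟨fun t => (AffineMap.lineMap a b (t : ℝ), m (AffineMap.lineMap a b (t : ℝ))),
    by fun_prop⟩, by simp, by simp⟩, fun s t hst => ⟨hl hst, hmono (hl hst)⟩, fun t => h _ ⟨?_, ?_⟩⟩
  · simpa using hl t.2.1
  · simpa using hl t.2.2

theorem graph_swap {n : ℝ → ℝ} (hn : Continuous n) (hmono : Monotone n) {a b : ℝ} (hab : a ≤ b)
    (h : ∀ y ∈ Icc a b, (n y, y) ∈ G) : MonoReach G (n a, a) (n b, b) := by
  exact (graph (G := Prod.swap ⁻¹' G) hn hmono hab h).swap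

end MonoReach

/-! ### Rerouting a matching through cells with unimodal rows and columns -/

/-- The function `f` decreases on `[a, m]` and increases on `[m, b]`. -/
structure IsUnimodal {α : Type*} [LinearOrder α] (f : ℝ → α) (a b m : ℝ) : Prop where
  mem : m ∈ Icc a b
  antitoneOn : AntitoneOn f (Icc a m)
  monotoneOn : MonotoneOn f (Icc m b)

theorem IsUnimodal.apply_le {α : Type*} [LinearOrder α] {f : ℝ → α} {a b m : ℝ}
    (h : IsUnimodal f a b m) {y : ℝ} (hy : y ∈ Icc a b) : f m ≤ f y := by
  rcases le_total y m with hm | hm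
  · exact h.antitoneOn ⟨hy.1, hm⟩ ⟨h.mem.1, le_rfl⟩ hm
  · exact h.monotoneOn ⟨le_rfl, h.mem.2⟩ ⟨hm, hy.2⟩ hm

/-- In a cell in which all rows and columns are unimodal, a point of low cost on the bottom edge,
from which the right edge can be reached at low cost, allows one to follow the row minima and then
the column minima. -/
theorem MonoReach.of_cell {α : Type*} [LinearOrder α] {D : ℝ → ℝ → α} {xl xr yb yt : ℝ}
    {m n : ℝ → ℝ} (hm : Continuous m) (hmm : Monotone m) (hn : Continuous n) (hnm : Monotone n)
    (hmD : ∀ x, IsUnimodal (D x ·) yb yt (m x)) (hnD : ∀ y, IsUnimodal (D · y) xl xr (n y))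
    {ε : α} {xe : ℝ} (hxe : xe ∈ Icc xl xr) (hε : D xe yb ≤ ε)
    (hhit : ∀ x ∈ Icc xe xr, ∃ y ∈ Icc yb yt, D x y ≤ ε) {G : Set (ℝ × ℝ)}
    (hGm : ∀ x ∈ Icc xl xr, D x (m x) ≤ ε → (x, m x) ∈ G)
    (hGn : ∀ y ∈ Icc yb yt, D (n y) y ≤ ε → (n y, y) ∈ G) :
    MonoReach G (n yb, yb) (xr, m xr) := by
  have hM : ∀ x ∈ Icc xe xr, D x (m x) ≤ ε := fun x hx =>
    let ⟨y, hy, hxy⟩ := hhit x hx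
    ((hmD x).apply_le hy).trans hxy
  have hxe' : ∀ y ∈ Icc yb (m xe), D xe y ≤ ε := fun y hy =>
    ((hmD xe).antitoneOn ⟨le_rfl, (hmD xe).mem.1⟩ hy hy.1).trans hε
  have hN : ∀ y ∈ Icc yb (m xe), D (n y) y ≤ ε := fun y hy =>
    ((hnD y).apply_le hxe).trans (hxe' y hy)
  -- A zero of this function is a crossing of the two curves of minima. The route climbs along (n y,
  -- y) up to the crossing and then follows (x, m x).
  have hφ : Continuous fun x => n (m x) - x := by fun_prop
  have hφr : n (m xr) - xr ≤ 0 := sub_nonpos.mpr (hnD _).mem.2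
  have hφl : 0 ≤ n (m xl) - xl := sub_nonneg.mpr (hnD _).mem.1
  have finish : ∀ x ∈ Icc xl xr, n (m x) - x = 0 → (∀ y ∈ Icc yb (m x), D (n y) y ≤ ε) →
      (∀ z ∈ Icc x xr, D z (m z) ≤ ε) → MonoReach G (n yb, yb) (xr, m xr) := by
    intro x hx hx0 hy hz
    have h1 := MonoReach.graph_swap hn hnm (hmD x).mem.1
      (fun y hy' => hGn y ⟨hy'.1, hy'.2.trans (hmD x).mem.2⟩ (hy y hy'))
    rw [sub_eq_zero.mp hx0] at h1
    exact h1.trans (MonoReach.graph hm hmm hx.2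
      (fun z hz' => hGm z ⟨hx.1.trans hz'.1, hz'.2⟩ (hz z hz')))
  rcases le_total 0 (n (m xe) - xe) with h | h
  · obtain ⟨x, hx, hx0⟩ := intermediate_value_Icc' hxe.2 hφ.continuousOn ⟨hφr, h⟩
    refine finish x ⟨hxe.1.trans hx.1, hx.2⟩ hx0 (fun y hy => ?_)
      fun z hz => hM z ⟨hx.1.trans hz.1, hz.2⟩
    -- Crossing to the right of `xe`: above m xe, each height is m z for some z, and minimizing
    -- along its horizontal line does not exceed the cost at (z, m z).
    rcases le_total y (m xe) with hy' | hy'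
    · exact hN y ⟨hy.1, hy'⟩
    · obtain ⟨z, hz, rfl⟩ := intermediate_value_Icc hx.1 hm.continuousOn ⟨hy', hy.2⟩
      exact ((hnD _).apply_le ⟨hxe.1.trans hz.1, hz.2.trans hx.2⟩).trans (hM z ⟨hz.1, hz.2.trans hx.2⟩)
  · obtain ⟨x, hx, hx0⟩ := intermediate_value_Icc' hxe.1 hφ.continuousOn ⟨h, hφl⟩
    refine finish x ⟨hx.1, hx.2.trans hxe.2⟩ hx0
      (fun y hy => hN y ⟨hy.1, hy.2.trans (hmm hx.2)⟩) fun z hz => ?_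
    -- Crossing to the left of `xe`: up to n (m xe), compare with the point (n y, y) above z. Beyond
    -- it, compare with height m xe, on which the cost increases towards `xe`.
    rcases le_total xe z with hz' | hz'
    · exact hM z ⟨hz', hz.2⟩
    rcases le_total z (n (m xe)) with hzn | hzn
    · obtain ⟨y, hy, rfl⟩ := intermediate_value_Icc (hmm hx.2) hn.continuousOn
        ⟨(sub_eq_zero.mp hx0).trans_le hz.1, hzn⟩
      have hy' : y ∈ Icc yb (m xe) := ⟨(hmD x).mem.1.trans hy.1, hy.2⟩
      exact ((hmD _).apply_le ⟨hy'.1, hy'.2.trans (hmD xe).mem.2⟩).trans (hN y hy')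
    · exact ((hmD z).apply_le (hmD xe).mem).trans <|
        ((hnD (m xe)).monotoneOn ⟨hzn, hz.2⟩ ⟨hzn.trans hz', hxe.2⟩ hz').trans
          (hxe' _ ⟨(hmD xe).mem.1, le_rfl⟩)

/-- A cost function on the parameter square with a grid, such that all rows and columns of the
cells are unimodal, with continuous monotone functions that select minima. -/
structure UnimodalGrid (α : Type*) [LinearOrder α] where
  D : ℝ → ℝ → α
  M : ℕ
  N : ℕ
  X : ℕ → ℝ
  Y : ℕ → ℝ
  X_zero : X 0 = 0
  Y_zero : Y 0 = 0
  X_last : X M = 1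
  Y_last : Y N = 1
  X_mono : Monotone X
  Y_mono : Monotone Y
  m : ℕ → ℝ → ℝ
  n : ℕ → ℝ → ℝ
  m_cont : ∀ j < N, Continuous (m j)
  m_mono : ∀ j < N, Monotone (m j)
  n_cont : ∀ i < M, Continuous (n i)
  n_mono : ∀ i < M, Monotone (n i)
  m_unimodal : ∀ j < N, ∀ x, IsUnimodal (D x ·) (Y j) (Y (j + 1)) (m j x)
  n_unimodal : ∀ i < M, ∀ y, IsUnimodal (D · y) (X i) (X (i + 1)) (n i y)

namespace UnimodalGrid

variable {α : Type*} [LinearOrder α] (W : UnimodalGrid α)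

/-- The grid with the two coordinates exchanged. -/
def swap : UnimodalGrid α where
  D x y := W.D y x
  M := W.N
  N := W.M
  X := W.Y
  Y := W.X
  X_zero := W.Y_zero
  Y_zero := W.X_zero
  X_last := W.Y_last
  Y_last := W.X_last
  X_mono := W.Y_mono
  Y_mono := W.X_mono
  m := W.n
  n := W.m
  m_cont := W.n_cont
  m_mono := W.n_mono
  n_cont := W.m_cont
  n_mono := W.m_mono
  m_unimodal := W.n_unimodal
  n_unimodal := W.m_unimodal

/-- The points of cost at most `ε` that lie on the grid or that are minima in the row or the column
of a cell. -/
def good (ε : α) : Set (ℝ × ℝ) :=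
  {z | z ∈ Icc 0 1 ∧ W.D z.1 z.2 ≤ ε ∧ ((∃ i ≤ W.M, z.1 = W.X i) ∨ (∃ j ≤ W.N, z.2 = W.Y j) ∨
    (∃ j < W.N, z.2 = W.m j z.1) ∨ ∃ i < W.M, z.1 = W.n i z.2)}

theorem good_swap (ε : α) : Prod.swap ⁻¹' W.swap.good ε = W.good ε := by
  ext z
  have h01 : z.swap ∈ Icc (0 : ℝ × ℝ) 1 ↔ z ∈ Icc (0 : ℝ × ℝ) 1 :=
    and_congr and_comm and_comm
  have hor : ∀ a b c d : Prop, (b ∨ a ∨ d ∨ c) ↔ (a ∨ b ∨ c ∨ d) := by tauto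
  exact and_congr h01 (and_congr Iff.rfl (hor _ _ _ _))

theorem X_mem {i : ℕ} (hi : i ≤ W.M) : W.X i ∈ Icc (0 : ℝ) 1 :=
  ⟨W.X_zero ▸ W.X_mono (Nat.zero_le i), W.X_last ▸ W.X_mono hi⟩

theorem Y_mem {j : ℕ} (hj : j ≤ W.N) : W.Y j ∈ Icc (0 : ℝ) 1 := W.swap.X_mem hj

theorem mem_good_m {ε : α} {j : ℕ} (hj : j < W.N) {x : ℝ} (hx : x ∈ Icc (0 : ℝ) 1)
    (h : W.D x (W.m j x) ≤ ε) : (x, W.m j x) ∈ W.good ε := by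
  have h1 := (W.m_unimodal j hj x).mem
  exact ⟨⟨⟨hx.1, (W.Y_mem hj.le).1.trans h1.1⟩, ⟨hx.2, h1.2.trans (W.Y_mem hj).2⟩⟩, h,
    Or.inr (Or.inr (Or.inl ⟨j, hj, rfl⟩))⟩

theorem mem_good_n {ε : α} {i : ℕ} (hi : i < W.M) {y : ℝ} (hy : y ∈ Icc (0 : ℝ) 1)
    (h : W.D (W.n i y) y ≤ ε) : (W.n i y, y) ∈ W.good ε := by
  have h1 := (W.n_unimodal i hi y).mem
  exact ⟨⟨⟨(W.X_mem hi.le).1.trans h1.1, hy.1⟩, ⟨h1.2.trans (W.X_mem hi).2, hy.2⟩⟩, h,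
    Or.inr (Or.inr (Or.inr ⟨i, hi, rfl⟩))⟩

/-- A monotone path of cost at most `ε` through the parameter square. -/
structure IsMatching (f g : ℝ → ℝ) (ε : α) : Prop where
  f_cont : Continuous f
  g_cont : Continuous g
  f_mono : Monotone f
  g_mono : Monotone g
  f_zero : f 0 = 0
  g_zero : g 0 = 0
  f_one : f 1 = 1
  g_one : g 1 = 1
  cost : ∀ t ∈ Icc (0 : ℝ) 1, W.D (f t) (g t) ≤ ε

variable {W} {f g : ℝ → ℝ} {ε : α}

theorem IsMatching.swap (h : W.IsMatching f g ε) : W.swap.IsMatching g f ε :=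
  ⟨h.g_cont, h.f_cont, h.g_mono, h.f_mono, h.g_zero, h.f_zero, h.g_one, h.f_one, h.cost⟩

/-- If the path meets an edge on the left side of the square, the minimum on that edge is
reachable. -/
theorem IsMatching.reach_left (h : W.IsMatching f g ε) {j : ℕ} (hj : j < W.N) {t : ℝ}
    (ht : t ∈ Icc (0 : ℝ) 1) (hft : f t = 0) (hgt : g t ∈ Icc (W.Y j) (W.Y (j + 1))) :
    MonoReach (W.good ε) (0, 0) (0, W.m j 0) := by
  have hmem := (W.m_unimodal j hj 0).mem
  have h0 := (W.Y_mem hj.le).1.trans hmem.1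
  refine MonoReach.graph_swap (n := fun _ => 0) continuous_const monotone_const h0 fun y hy => ?_
  refine ⟨⟨⟨le_rfl, hy.1⟩, ⟨zero_le_one, hy.2.trans (hmem.2.trans (W.Y_mem hj).2)⟩⟩, ?_,
    Or.inl ⟨0, Nat.zero_le _, W.X_zero.symm⟩⟩
  -- Below g t the matching itself runs along the left side; above, the cost falls towards the
  -- minimum.
  rcases le_total y (g t) with hyt | hyt
  · obtain ⟨s, hs, rfl⟩ := intermediate_value_Icc ht.1 h.g_cont.continuousOn
      ⟨h.g_zero.trans_le hy.1, hyt⟩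
    have hfs : f s = 0 := le_antisymm (hft ▸ h.f_mono hs.2) (h.f_zero ▸ h.f_mono hs.1)
    simpa [hfs] using h.cost s ⟨hs.1, hs.2.trans ht.2⟩
  · have h1 := (W.m_unimodal j hj 0).antitoneOn ⟨hgt.1, hyt.trans hy.2⟩ ⟨hgt.1.trans hyt, hy.2⟩ hyt
    exact h1.trans (by simpa [hft] using h.cost t ht)

/-- The later of the times s₁ and s₂, at which the matching meets the lines of the left and bottom
sides, is its entry into the cell. After a left entry the curve of minima stays cheap across the
cell; a bottom entry is the case of `MonoReach.of_cell`. -/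
theorem IsMatching.reach_step (h : W.IsMatching f g ε) {i j : ℕ} (hi : i < W.M) (hj : j < W.N)
    {t : ℝ} (ht : t ∈ Icc (0 : ℝ) 1) (hft : f t = W.X (i + 1))
    (hgt : g t ∈ Icc (W.Y j) (W.Y (j + 1)))
    (hV : ∀ s ∈ Icc (0 : ℝ) 1, f s = W.X i → g s ∈ Icc (W.Y j) (W.Y (j + 1)) →
      MonoReach (W.good ε) (0, 0) (W.X i, W.m j (W.X i)))
    (hH : ∀ s ∈ Icc (0 : ℝ) 1, g s = W.Y j → f s ∈ Icc (W.X i) (W.X (i + 1)) →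
      MonoReach (W.good ε) (0, 0) (W.n i (W.Y j), W.Y j)) :
    MonoReach (W.good ε) (0, 0) (W.X (i + 1), W.m j (W.X (i + 1))) := by
  have hXi : W.X i ≤ W.X (i + 1) := W.X_mono (Nat.le_succ i)
  have hX01 : ∀ x ∈ Icc (W.X i) (W.X (i + 1)), x ∈ Icc (0 : ℝ) 1 := fun x hx =>
    ⟨(W.X_mem hi.le).1.trans hx.1, hx.2.trans (W.X_mem hi).2⟩
  have hY01 : ∀ y ∈ Icc (W.Y j) (W.Y (j + 1)), y ∈ Icc (0 : ℝ) 1 := fun y hy =>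
    ⟨(W.Y_mem hj.le).1.trans hy.1, hy.2.trans (W.Y_mem hj).2⟩
  obtain ⟨s₁, hs₁, hfs⟩ := intermediate_value_Icc ht.1 h.f_cont.continuousOn
    ⟨h.f_zero.trans_le (W.X_mem hi.le).1, hXi.trans_eq hft.symm⟩
  obtain ⟨s₂, hs₂, hgs⟩ := intermediate_value_Icc ht.1 h.g_cont.continuousOn
    ⟨h.g_zero.trans_le (W.Y_mem hj.le).1, hgt.1⟩
  have hhit : ∀ s ∈ Icc 0 t, W.Y j ≤ g s → ∀ x ∈ Icc (f s) (W.X (i + 1)),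
      ∃ y ∈ Icc (W.Y j) (W.Y (j + 1)), W.D x y ≤ ε := by
    intro s hs hgs x hx
    obtain ⟨u, hu, rfl⟩ := intermediate_value_Icc hs.2 h.f_cont.continuousOn
      ⟨hx.1, hx.2.trans_eq hft.symm⟩
    exact ⟨g u, ⟨hgs.trans (h.g_mono hu.1), (h.g_mono hu.2).trans hgt.2⟩,
      h.cost u ⟨hs.1.trans hu.1, hu.2.trans ht.2⟩⟩
  rcases le_total s₂ s₁ with hs | hs
  · have hg₁ : W.Y j ≤ g s₁ := hgs ▸ h.g_mono hs
    refine (hV s₁ ⟨hs₁.1, hs₁.2.trans ht.2⟩ hfs ⟨hg₁, (h.g_mono hs₁.2).trans hgt.2⟩).trans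
      (MonoReach.graph (W.m_cont j hj) (W.m_mono j hj) hXi fun x hx =>
        W.mem_good_m hj (hX01 x hx) ?_)
    obtain ⟨y, hy, hxy⟩ := hhit s₁ hs₁ hg₁ x (hfs.symm ▸ hx)
    exact ((W.m_unimodal j hj x).apply_le hy).trans hxy
  · have hf₂ : f s₂ ∈ Icc (W.X i) (W.X (i + 1)) := ⟨hfs ▸ h.f_mono hs, hft ▸ h.f_mono hs₂.2⟩
    have hs₂' : s₂ ∈ Icc (0 : ℝ) 1 := ⟨hs₂.1, hs₂.2.trans ht.2⟩
    exact (hH s₂ hs₂' hgs hf₂).trans (MonoReach.of_cell (W.m_cont j hj) (W.m_mono j hj)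
      (W.n_cont i hi) (W.n_mono i hi) (W.m_unimodal j hj) (W.n_unimodal i hi) hf₂
      (hgs ▸ h.cost s₂ hs₂') (hhit s₂ hs₂ hgs.ge) (fun x hx => W.mem_good_m hj (hX01 x hx))
      fun y hy => W.mem_good_n hi (hY01 y hy))

/-- The minimum of every grid edge that the path meets is reachable. -/
theorem IsMatching.reach (s : ℕ) : ∀ {W : UnimodalGrid α} {f g : ℝ → ℝ}
    (_ : W.IsMatching f g ε) {i j : ℕ} (_ : i + j = s) (_ : i ≤ W.M) (_ : j < W.N) {t : ℝ}
    (_ : t ∈ Icc (0 : ℝ) 1) (_ : f t = W.X i) (_ : g t ∈ Icc (W.Y j) (W.Y (j + 1))),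
    MonoReach (W.good ε) (0, 0) (W.X i, W.m j (W.X i)) := by
  -- The grid is generalized because reaching a minimum on a bottom edge is reaching one on a left
  -- edge of the swapped grid; both predecessors of a cell have a smaller index sum.
  induction s with
  | zero =>
    intro W f g h i j hij hi hj t ht hft hgt
    obtain ⟨rfl, rfl⟩ : i = 0 ∧ j = 0 := by omega
    rw [W.X_zero] at hft ⊢
    exact h.reach_left hj ht hft hgt
  | succ s ih =>
    intro W f g h i j hij hi hj t ht hft hgt
    cases i with
    | zero =>
      rw [W.X_zero] at hft ⊢
      exact h.reach_left hj ht hft hgt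
    | succ i =>
      refine h.reach_step hi hj ht hft hgt (fun u hu hfu hgu =>
        ih h (by omega) (by omega) hj hu hfu hgu) fun u hu hgu hfu => ?_
      have := (ih h.swap (i := j) (j := i) (by omega) hj.le hi hu hgu hfu).swap
      rw [W.good_swap] at this
      exact this

/-- The minimum of the topmost edge on the right side is reachable; from there the cost increases up
to the corner, where the matching ends. -/
theorem IsMatching.exists_good (h : W.IsMatching f g ε) : MonoReach (W.good ε) (0, 0) (1, 1) := by
  obtain ⟨j, hj⟩ : ∃ j, W.N = j + 1 := Nat.exists_eq_succ_of_ne_zero fun h0 => by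
    have := W.Y_last
    rw [h0, W.Y_zero] at this
    exact zero_ne_one this
  have hj' : j < W.N := by omega
  have hY : W.Y (j + 1) = 1 := hj ▸ W.Y_last
  have h1 := IsMatching.reach (W.M + j) h rfl le_rfl hj' (t := 1) ⟨zero_le_one, le_rfl⟩
    (by rw [h.f_one, W.X_last]) (by
      rw [h.g_one, hY]; exact ⟨(W.Y_mem hj'.le).2, le_rfl⟩)
  rw [W.X_last] at h1
  have hmem := (W.m_unimodal j hj' 1).mem
  rw [hY] at hmem
  refine h1.trans (MonoReach.graph_swap (n := fun _ => 1) continuous_const monotone_const hmem.2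
    fun y hy => ⟨⟨⟨zero_le_one, ((W.Y_mem hj'.le).1.trans hmem.1).trans hy.1⟩, ⟨le_rfl, hy.2⟩⟩, ?_,
      Or.inl ⟨W.M, le_rfl, W.X_last.symm⟩⟩)
  have h2 := (W.m_unimodal j hj' 1).monotoneOn ⟨hy.1, hY ▸ hy.2⟩ ⟨hmem.2, hY.ge⟩ hy.2
  exact h2.trans (by simpa [h.f_one, h.g_one] using h.cost 1 ⟨zero_le_one, le_rfl⟩)

end UnimodalGrid

/-! ### Strictly quasiconvex functions -/

/-- Comparison with a minimizer makes f monotone on each side of it, and a second minimizer would be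
undercut by the midpoint. -/
theorem exists_isUnimodal {f : ℝ → ℝ≥0∞} {a b : ℝ} (hab : a ≤ b) (hf : ContinuousOn f (Icc a b))
    (hq : ∀ x ∈ Icc a b, ∀ z ∈ Icc a b, ∀ y ∈ Ioo x z, f y < max (f x) (f z)) :
    ∃ m, IsUnimodal f a b m ∧ ∀ y ∈ Icc a b, y ≠ m → f m < f y := by
  obtain ⟨m, hm, hmin⟩ := isCompact_Icc.exists_isMinOn (nonempty_Icc.mpr hab) hf
  refine ⟨m, ⟨hm, fun x hx y hy hxy => ?_, fun x hx y hy hxy => ?_⟩, fun y hy hne => ?_⟩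
  · have hx' : x ∈ Icc a b := ⟨hx.1, hx.2.trans hm.2⟩
    have hy' : y ∈ Icc a b := ⟨hy.1, hy.2.trans hm.2⟩
    rcases hxy.eq_or_lt with rfl | hxy
    · exact le_rfl
    rcases hy.2.eq_or_lt with rfl | hym
    · exact hmin hx'
    · exact ((lt_max_iff.mp (hq x hx' m hm y ⟨hxy, hym⟩)).resolve_right (hmin hy').not_gt).le
  · have hx' : x ∈ Icc a b := ⟨hm.1.trans hx.1, hx.2⟩
    have hy' : y ∈ Icc a b := ⟨hm.1.trans hy.1, hy.2⟩
    rcases hxy.eq_or_lt with rfl | hxy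
    · exact le_rfl
    rcases hx.1.eq_or_lt with rfl | hxm
    · exact hmin hy'
    · exact ((lt_max_iff.mp (hq m hm y hy' x ⟨hxm, hxy⟩)).resolve_left (hmin hx').not_gt).le
  · refine (hmin hy).lt_of_ne fun heq => ?_
    rcases lt_or_gt_of_ne hne with h | h
    · have hc : (y + m) / 2 ∈ Ioo y m := ⟨by linarith, by linarith⟩
      have := hq y hy m hm _ hc
      rw [← heq, max_self] at this
      exact (hmin (⟨hy.1.trans hc.1.le, hc.2.le.trans hm.2⟩ : (y + m) / 2 ∈ Icc a b)).not_gt this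
    · have hc : (m + y) / 2 ∈ Ioo m y := ⟨by linarith, by linarith⟩
      have := hq m hm y hy _ hc
      rw [← heq, max_self] at this
      exact (hmin (⟨hm.1.trans hc.1.le, hc.2.le.trans hy.2⟩ : (m + y) / 2 ∈ Icc a b)).not_gt this

/-- The minima of the columns of a strictly quasiconvex Monge cost function depend continuously and
monotonically on the column. -/
theorem exists_minimum_selection {D : ℝ → ℝ → ℝ≥0∞} (hD : Continuous fun z : ℝ × ℝ => D z.1 z.2)
    (hmonge : ∀ x x' y y', x ≤ x' → y ≤ y' → D x y + D x' y' ≤ D x y' + D x' y)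
    {a b : ℝ} (hab : a ≤ b)
    (hq : ∀ r, ∀ x ∈ Icc a b, ∀ z ∈ Icc a b, ∀ y ∈ Ioo x z, D r y < max (D r x) (D r z)) :
    ∃ m : ℝ → ℝ, Continuous m ∧ Monotone m ∧ (∀ x, IsUnimodal (D x ·) a b (m x)) ∧
      ∀ x, ∀ y ∈ Icc a b, y ≠ m x → D x (m x) < D x y := by
  have hcol : ∀ x, Continuous (D x ·) := fun x =>
    hD.comp (continuous_const.prodMk continuous_id)
  have hrow : ∀ y, Continuous (D · y) := fun y =>
    hD.comp (continuous_id.prodMk continuous_const)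
  choose m hm hmin using fun x => exists_isUnimodal hab (hcol x).continuousOn (hq x)
  refine ⟨m, continuous_iff_continuousAt.mpr fun x₀ => ?_, fun x x' hx => ?_, hm, hmin⟩
  · refine tendsto_order.mpr ⟨fun c hc => ?_, fun c hc => ?_⟩
    -- For c < m x₀ the strict inequality between the costs at m x₀ and c persists for nearby x, and
    -- unimodality then excludes m x ≤ c. The upper bound is symmetric.
    · rcases lt_or_ge c a with hca | hca
      · exact Filter.Eventually.of_forall fun x => hca.trans_le (hm x).mem.1
      have hlt := hmin x₀ c ⟨hca, hc.le.trans (hm x₀).mem.2⟩ hc.ne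
      filter_upwards [(hrow _).continuousAt.eventually_lt (hrow _).continuousAt hlt] with x hx
      by_contra! hcon
      exact hx.not_ge ((hm x).monotoneOn ⟨hcon, hc.le.trans (hm x₀).mem.2⟩
        ⟨hcon.trans hc.le, (hm x₀).mem.2⟩ hc.le)
    · rcases lt_or_ge b c with hcb | hcb
      · exact Filter.Eventually.of_forall fun x => (hm x).mem.2.trans_lt hcb
      have hlt := hmin x₀ c ⟨(hm x₀).mem.1.trans hc.le, hcb⟩ hc.ne'
      filter_upwards [(hrow _).continuousAt.eventually_lt (hrow _).continuousAt hlt] with x hx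
      by_contra! hcon
      exact hx.not_ge ((hm x).antitoneOn ⟨(hm x₀).mem.1, hc.le.trans hcon⟩
        ⟨(hm x₀).mem.1.trans hc.le, hcon⟩ hc.le)
  -- Exchanging decreasing minimizers would contradict the Monge inequality by strict minimality.
  · by_contra! hlt
    have h1 := hmin x _ (hm x').mem hlt.ne
    have h2 := hmin x' _ (hm x).mem hlt.ne'
    exact (hmonge x x' _ _ hx hlt.le).not_gt (ENNReal.add_lt_add h1 h2)

/-! ### Polygonal curves -/

namespace PolygonalCurve

variable (F : PolygonalCurve)

/-- The parameters of the vertices of a polygonal curve, indexed by the natural numbers. -/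
noncomputable def knotI (i : ℕ) : I := F.τ ⟨min i F.numEdges, by omega⟩

/-- The parameters of the vertices of a polygonal curve, as real numbers. -/
noncomputable def knot (i : ℕ) : ℝ := F.knotI i

theorem knotI_mono : Monotone F.knotI := fun i j hij =>
  F.τ_strictMono.monotone (by rw [Fin.mk_le_mk]; omega)

theorem knot_mono : Monotone F.knot := fun _ _ hij => F.knotI_mono hij

theorem knot_lt {i : ℕ} (hi : i < F.numEdges) : F.knot i < F.knot (i + 1) :=
  F.τ_strictMono (by rw [Fin.mk_lt_mk]; omega)

theorem knot_zero : F.knot 0 = 0 := by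
  have : F.knotI 0 = 0 := by
    rw [← F.τ_zero, knotI]; congr 1
  rw [knot, this, Icc.coe_zero]

theorem knot_last : F.knot F.numEdges = 1 := by
  have : F.knotI F.numEdges = 1 := by
    rw [← F.τ_last, knotI]; congr 1
    ext; simp
  rw [knot, this, Icc.coe_one]

theorem numEdges_pos : 0 < F.numEdges := by
  by_contra h
  have h0 : F.numEdges = 0 := by omega
  have := F.knot_last
  rw [h0, F.knot_zero] at this
  exact zero_ne_one this

theorem isVertex_knotI (i : ℕ) : F.IsVertex (F (F.knotI i)) := ⟨_, rfl⟩

theorem apply_eq_lineMap {i : ℕ} (hi : i < F.numEdges) {x : I}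
    (hx : (x : ℝ) ∈ Icc (F.knot i) (F.knot (i + 1))) :
    F x = AffineMap.lineMap (F (F.knotI i)) (F (F.knotI (i + 1)))
      (((x : ℝ) - F.knot i) / (F.knot (i + 1) - F.knot i)) := by
  have h1 : F.τ (Fin.castSucc ⟨i, hi⟩) = F.knotI i := by
    rw [knotI]; congr 1; ext; simp; omega
  have h2 : F.τ (Fin.succ ⟨i, hi⟩) = F.knotI (i + 1) := by
    rw [knotI]; congr 1; ext; simp; omega
  have := F.affine ⟨i, hi⟩ x (by rw [h1, h2]; exact hx)
  rw [h1, h2] at this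
  exact this

theorem exists_mem_band (x : I) :
    ∃ i < F.numEdges, (x : ℝ) ∈ Icc (F.knot i) (F.knot (i + 1)) := by
  classical
  have hex : ∃ i, (x : ℝ) ≤ F.knot i := ⟨F.numEdges, F.knot_last ▸ x.2.2⟩
  have hle : Nat.find hex ≤ F.numEdges := Nat.find_min' hex (F.knot_last ▸ x.2.2)
  rcases Nat.eq_zero_or_pos (Nat.find hex) with h | h
  · have h0 := Nat.find_spec hex
    rw [h] at h0
    exact ⟨0, F.numEdges_pos, F.knot_zero ▸ x.2.1, h0.trans (F.knot_mono (Nat.zero_le _))⟩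
  · refine ⟨Nat.find hex - 1, by omega, ?_, ?_⟩
    · exact (not_le.mp (Nat.find_min hex (m := Nat.find hex - 1) (by omega))).le
    · rw [Nat.sub_add_cancel h]; exact Nat.find_spec hex

theorem lineMap_mem_range {i : ℕ} (hi : i < F.numEdges) {s : ℝ} (hs : s ∈ Icc (0 : ℝ) 1) :
    AffineMap.lineMap (F (F.knotI i)) (F (F.knotI (i + 1))) s ∈ range F := by
  have hlt := F.knot_lt hi
  have h0 : 0 ≤ F.knot i := (F.knotI i).2.1
  have h1 : F.knot (i + 1) ≤ 1 := (F.knotI (i + 1)).2.2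
  have hx : F.knot i + s * (F.knot (i + 1) - F.knot i) ∈ Icc (F.knot i) (F.knot (i + 1)) :=
    ⟨by nlinarith [hs.1], by nlinarith [hs.2]⟩
  refine ⟨⟨_, h0.trans hx.1, hx.2.trans h1⟩, ?_⟩
  rw [F.apply_eq_lineMap hi hx]
  congr 1
  have : F.knot (i + 1) - F.knot i ≠ 0 := by linarith
  field_simp
  ring

theorem segment_subset_range {i : ℕ} (hi : i < F.numEdges) :
    segment ℝ (F (F.knotI i)) (F (F.knotI (i + 1))) ⊆ range F := by
  rw [segment_eq_image_lineMap]
  rintro _ ⟨s, hs, rfl⟩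
  exact F.lineMap_mem_range hi hs

theorem ratio_mem {i : ℕ} (hi : i < F.numEdges) {x : ℝ} (hx : x ∈ Icc (F.knot i) (F.knot (i + 1))) :
    (x - F.knot i) / (F.knot (i + 1) - F.knot i) ∈ Icc (0 : ℝ) 1 := by
  have hlt := F.knot_lt hi
  have h1 := hx.1
  have h2 := hx.2
  exact ⟨div_nonneg (by linarith) (by linarith), (div_le_one (by linarith)).mpr (by linarith)⟩

/-- The part of an edge between two of its points is a straight segment on the curve. -/
theorem segment_subset_range_of_mem {i : ℕ} (hi : i < F.numEdges) {x y : I}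
    (hx : (x : ℝ) ∈ Icc (F.knot i) (F.knot (i + 1)))
    (hy : (y : ℝ) ∈ Icc (F.knot i) (F.knot (i + 1))) : segment ℝ (F x) (F y) ⊆ range F := by
  refine Subset.trans ?_ (F.segment_subset_range hi)
  refine (convex_segment _ _).segment_subset ?_ ?_
  · rw [F.apply_eq_lineMap hi hx, segment_eq_image_lineMap]
    exact mem_image_of_mem _ (F.ratio_mem hi hx)
  · rw [F.apply_eq_lineMap hi hy, segment_eq_image_lineMap]
    exact mem_image_of_mem _ (F.ratio_mem hi hy)

/-- Near x₀ the finitely many closed bands that miss x₀ are avoided, so nearby points share an edge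
with x₀ and are joined to it by a straight segment. -/
theorem eventually_mem_band (x₀ : I) : ∀ᶠ x : I in 𝓝 x₀, ∃ i < F.numEdges,
    (x₀ : ℝ) ∈ Icc (F.knot i) (F.knot (i + 1)) ∧ (x : ℝ) ∈ Icc (F.knot i) (F.knot (i + 1)) := by
  have h : ∀ i ∈ Finset.range F.numEdges, ∀ᶠ x : I in 𝓝 x₀,
      (x : ℝ) ∈ Icc (F.knot i) (F.knot (i + 1)) → (x₀ : ℝ) ∈ Icc (F.knot i) (F.knot (i + 1)) := by
    intro i _
    by_cases hx : (x₀ : ℝ) ∈ Icc (F.knot i) (F.knot (i + 1))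
    · exact Filter.Eventually.of_forall fun _ _ => hx
    · have : IsOpen {x : I | (x : ℝ) ∉ Icc (F.knot i) (F.knot (i + 1))} :=
        (isClosed_Icc.preimage continuous_subtype_val).isOpen_compl
      filter_upwards [this.mem_nhds hx] with x hx' h
      exact absurd h hx'
  filter_upwards [(Filter.eventually_all_finset _).mpr h] with x hx
  obtain ⟨i, hi, hxi⟩ := F.exists_mem_band x
  exact ⟨i, hi, hx i (Finset.mem_range.mpr hi) hxi, hxi⟩

variable {F} {k : ℕ} [NeZero k] {P : SimplePolygon k}

theorem eventually_geodist_le (hF : range F ⊆ P.bdry) (x₀ : I) :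
    ∀ᶠ x in 𝓝 x₀, P.geodist (F x₀) (F x) ≤ edist (F x₀) (F x) := by
  filter_upwards [F.eventually_mem_band x₀] with x ⟨i, hi, h0, hx⟩
  exact P.geodist_le_edist (((F.segment_subset_range_of_mem hi h0 hx).trans hF).trans
    P.bdry_subset_region)

/-- By the triangle inequality, moving both points changes the distance by at most their
straight-line displacements. Finiteness is needed for the lower bound by truncated subtraction. -/
theorem continuous_geodist {R B : PolygonalCurve} (hR : range R ⊆ P.bdry) (hB : range B ⊆ P.bdry)
    (hRc : Continuous R) (hBc : Continuous B) :
    Continuous fun z : I × I => P.geodist (R z.1) (B z.2) := by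
  refine continuous_iff_continuousAt.mpr fun z₀ => ?_
  set e : I × I → ℝ≥0∞ := fun z => edist (R z₀.1) (R z.1) + edist (B z₀.2) (B z.2) with he
  have hec : Continuous e := by fun_prop
  have he0 : Filter.Tendsto e (𝓝 z₀) (𝓝 0) := by
    have := hec.tendsto z₀
    simpa [he] using this
  have hfin : P.geodist (R z₀.1) (B z₀.2) ≠ ⊤ :=
    P.geodist_ne_top (hR (mem_range_self _)) (hB (mem_range_self _))
  have hev : ∀ᶠ z in 𝓝 z₀, P.geodist (R z₀.1) (R z.1) + P.geodist (B z₀.2) (B z.2) ≤ e z := by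
    rw [show 𝓝 z₀ = 𝓝 (z₀.1, z₀.2) from rfl, nhds_prod_eq]
    filter_upwards [(eventually_geodist_le hR z₀.1).prod_inl (𝓝 z₀.2),
      (eventually_geodist_le hB z₀.2).prod_inr (𝓝 z₀.1)] with z h1 h2
    exact add_le_add h1 h2
  have hlow := ENNReal.Tendsto.sub (tendsto_const_nhds (x := P.geodist (R z₀.1) (B z₀.2))
    (f := 𝓝 z₀)) he0 (Or.inl hfin)
  have hup := (tendsto_const_nhds (x := P.geodist (R z₀.1) (B z₀.2)) (f := 𝓝 z₀)).add he0
  rw [tsub_zero] at hlow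
  rw [add_zero] at hup
  refine tendsto_of_tendsto_of_tendsto_of_le_of_le' hlow hup ?_ ?_
  · filter_upwards [hev] with z hz
    rw [tsub_le_iff_right]
    calc P.geodist (R z₀.1) (B z₀.2)
        ≤ P.geodist (R z₀.1) (R z.1) + (P.geodist (R z.1) (B z.2) + P.geodist (B z.2) (B z₀.2)) :=
          (P.geodist_triangle _ _ _).trans (by gcongr; exact P.geodist_triangle _ _ _)
      _ = P.geodist (R z.1) (B z.2) +
          (P.geodist (R z₀.1) (R z.1) + P.geodist (B z₀.2) (B z.2)) := by
          rw [P.geodist_comm (B z.2)]; ring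
      _ ≤ _ := by gcongr
  · filter_upwards [hev] with z hz
    calc P.geodist (R z.1) (B z.2)
        ≤ P.geodist (R z.1) (R z₀.1) + (P.geodist (R z₀.1) (B z₀.2) + P.geodist (B z₀.2) (B z.2)) :=
          (P.geodist_triangle _ _ _).trans (by gcongr; exact P.geodist_triangle _ _ _)
      _ = P.geodist (R z₀.1) (B z₀.2) +
          (P.geodist (R z₀.1) (R z.1) + P.geodist (B z₀.2) (B z.2)) := by
          rw [P.geodist_comm (R z.1)]; ring
      _ ≤ _ := by gcongr

/-- A nondegenerate segment on the boundary has the slope of an edge of the polygon. -/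
theorem _root_.SimplePolygon.GeneralPosition.abs_ne (hP : P.GeneralPosition) {a b : Plane}
    (hab : a ≠ b) (hseg : segment ℝ a b ⊆ P.bdry) : |b 1 - a 1| ≠ |b 0 - a 0| := by
  -- Infinitely many points of the segment lie on finitely many edges, so two distinct ones share an
  -- edge, and the directions are parallel.
  have hmem : ∀ n : ℕ, ∃ i : Fin k, ∃ x : ℝ,
      AffineMap.lineMap (P.vertices i) (P.vertices (finRotate k i)) x =
        AffineMap.lineMap a b (1 / ((n : ℝ) + 1)) := by
    intro n
    have h1 : AffineMap.lineMap a b (1 / ((n : ℝ) + 1)) ∈ P.bdry := hseg (by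
      rw [segment_eq_image_lineMap]
      refine mem_image_of_mem _ ⟨by positivity, ?_⟩
      rw [div_le_one (by positivity)]
      linarith [n.cast_nonneg (α := ℝ)])
    obtain ⟨i, hi⟩ := mem_iUnion.mp h1
    obtain ⟨x, -, hx⟩ := hi
    exact ⟨i, x, hx⟩
  choose i x hx using hmem
  obtain ⟨n, n', hne, hnn⟩ := Finite.exists_ne_map_eq_of_infinite i
  intro habs
  have h1 := hx n
  have h2 := hx n'
  rw [← hnn] at h2
  set u := P.vertices (i n)
  set v := P.vertices (finRotate k (i n))
  set s : ℝ := 1 / ((n : ℝ) + 1)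
  set s' : ℝ := 1 / ((n' : ℝ) + 1)
  have hs : s ≠ s' := by
    intro h
    have h3 : (n : ℝ) + 1 ≠ 0 := by positivity
    have h4 : (n' : ℝ) + 1 ≠ 0 := by positivity
    simp only [s, s', one_div, inv_inj, add_left_inj, Nat.cast_inj] at h
    exact hne h
  have hcoord : ∀ c : Fin 2, (x n - x n') * (v c - u c) = (s - s') * (b c - a c) := by
    intro c
    have e1 := congrArg (fun z : Plane => z c) h1
    have e2 := congrArg (fun z : Plane => z c) h2
    simp only [AffineMap.lineMap_apply, vsub_eq_sub, vadd_eq_add, PiLp.add_apply, PiLp.smul_apply,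
      PiLp.sub_apply, smul_eq_mul] at e1 e2
    linear_combination e1 - e2
  have hxx : x n - x n' ≠ 0 := by
    intro h0
    refine hab ?_
    have h3 : ∀ c : Fin 2, a c = b c := by
      intro c
      have := hcoord c
      rw [h0, zero_mul] at this
      have := (mul_eq_zero.mp this.symm).resolve_left (sub_ne_zero.mpr hs)
      linarith
    ext c
    exact h3 c
  refine hP.1 (i n) (mul_left_cancel₀ (abs_ne_zero.mpr hxx) ?_)
  rw [← abs_mul, ← abs_mul, hcoord, hcoord, abs_mul, abs_mul, habs]

/-- Along a nondegenerate edge of the curve the distance to a boundary point is strictly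
quasiconvex. -/
theorem geodist_lt_max (hP : P.GeneralPosition) (hF : range F ⊆ P.bdry) {i : ℕ}
    (hi : i < F.numEdges) (hne : F (F.knotI i) ≠ F (F.knotI (i + 1))) {r : Plane} (hr : r ∈ P.bdry)
    {x y z : I} (hx : (x : ℝ) ∈ Icc (F.knot i) (F.knot (i + 1)))
    (hz : (z : ℝ) ∈ Icc (F.knot i) (F.knot (i + 1))) (hxy : x < y) (hyz : y < z) :
    P.geodist r (F y) < max (P.geodist r (F x)) (P.geodist r (F z)) := by
  have hxy' : (x : ℝ) < y := hxy
  have hyz' : (y : ℝ) < z := hyz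
  have hlt := F.knot_lt hi
  have hseg := (F.segment_subset_range_of_mem hi hx hz).trans hF
  have hpos : 0 < F.knot (i + 1) - F.knot i := by linarith
  have hinj := AffineMap.lineMap_injective ℝ hne
  have hxz : F x ≠ F z := by
    rw [F.apply_eq_lineMap hi hx, F.apply_eq_lineMap hi hz]
    intro h
    have := hinj h
    rw [div_left_inj' hpos.ne'] at this
    linarith
  refine P.geodist_lt_max (hseg.trans P.bdry_subset_region) ?_ (hP.abs_ne hxz hseg)
    (P.geodist_ne_top hr (hF (mem_range_self _))) (P.geodist_ne_top hr (hF (mem_range_self _)))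
  rw [openSegment_eq_image_lineMap]
  refine ⟨((y : ℝ) - x) / (z - x), ⟨div_pos (by linarith) (by linarith),
    (div_lt_one (by linarith)).mpr (by linarith)⟩, ?_⟩
  rw [F.apply_eq_lineMap hi hx, F.apply_eq_lineMap hi hz,
    F.apply_eq_lineMap hi (x := y) ⟨hx.1.trans hxy'.le, hyz'.le.trans hz.2⟩,
    ← AffineMap.apply_lineMap]
  congr 1
  rw [AffineMap.lineMap_apply]
  have : (z : ℝ) - x ≠ 0 := by linarith
  simp only [vsub_eq_sub, vadd_eq_add, smul_eq_mul]
  field_simp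
  ring

/-- A strict minimum of the distance along an edge of a simple curve is a locally closest point. -/
theorem IsSimple.locallyClosest (hFs : F.IsSimple) (hFc : Continuous F) {i : ℕ}
    (hi : i < F.numEdges) (hne : F (F.knotI i) ≠ F (F.knotI (i + 1))) {r : Plane} {y : I}
    (hy : (y : ℝ) ∈ Ioo (F.knot i) (F.knot (i + 1)))
    (hmin : ∀ y' : I, (y' : ℝ) ∈ Icc (F.knot i) (F.knot (i + 1)) → y' ≠ y →
      P.geodist r (F y) < P.geodist r (F y')) : LocallyClosest P F (F y) r := by
  refine ⟨mem_range_self y, ?_⟩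
  have hlt := F.knot_lt hi
  have hpos : 0 < F.knot (i + 1) - F.knot i := by linarith
  have hinj := AffineMap.lineMap_injective ℝ hne
  have hyI := Ioo_subset_Icc_self hy
  have hend : ∀ x : I, (x : ℝ) ∈ Icc (F.knot i) (F.knot (i + 1)) → F x = F y → x = y := by
    intro x hx h
    rw [F.apply_eq_lineMap hi hx, F.apply_eq_lineMap hi hyI] at h
    have := hinj h
    rw [div_left_inj' hpos.ne'] at this
    exact Subtype.ext (by linarith)
  -- The rest of the curve is compact and, by simplicity, misses F y: a second visit would collapse
  -- the curve up to an end of the edge. So points of the curve near F y come from this edge.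
  set S : Set I := {x | (x : ℝ) ∈ Ioo (F.knot i) (F.knot (i + 1))}ᶜ with hS
  have hSc : IsCompact S :=
    (isOpen_Ioo.preimage continuous_subtype_val).isClosed_compl.isCompact
  have hyS : F y ∉ F '' S := by
    rintro ⟨x, hx, hxy⟩
    have hoc := (hFs (F y)).out
    rcases le_or_gt (x : ℝ) (F.knot i) with h | h
    · have h1 : F.knotI i ∈ {x : I | F x = F y} :=
        hoc (x := x) hxy (y := y) rfl ⟨h, hy.1.le⟩
      have h2 := hend _ ⟨le_rfl, hlt.le⟩ h1
      exact hy.1.ne (congrArg Subtype.val h2)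
    · have h' : F.knot (i + 1) ≤ x := not_lt.mp fun h' => hx ⟨h, h'⟩
      have h1 : F.knotI (i + 1) ∈ {x : I | F x = F y} :=
        hoc (x := y) rfl (y := x) hxy ⟨hy.2.le, h'⟩
      have h2 := hend _ ⟨hlt.le, le_rfl⟩ h1
      exact hy.2.ne' (congrArg Subtype.val h2)
  filter_upwards [mem_nhdsWithin_of_mem_nhds ((hSc.image hFc).isClosed.isOpen_compl.mem_nhds hyS),
    self_mem_nhdsWithin] with b hb hb'
  obtain ⟨⟨x, rfl⟩, hbne⟩ := hb'
  have hxS : (x : ℝ) ∈ Ioo (F.knot i) (F.knot (i + 1)) := by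
    by_contra hc
    exact hb ⟨x, hc, rfl⟩
  exact hmin x (Ioo_subset_Icc_self hxS) fun h => hbne (by rw [h]; rfl)

end PolygonalCurve

/-! ### Boundary positions of oppositely oriented curves -/

namespace PolygonalCurve

variable {k : ℕ} [NeZero k] {P : SimplePolygon k} {R B F : PolygonalCurve}

/-- A simple curve does not run once around the polygon. -/
theorem IsSimple.abs_sub_lt (hF : F.IsSimple) {φ : I → ℝ} (hφ : Continuous φ)
    (hFφ : ∀ x, F x = P.toPolygon.boundaryPath (φ x)) (x y : I) : |φ x - φ y| < k := by
  by_contra! hcon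
  have hk : (0 : ℝ) < k := SimplePolygon.period_pos
  -- After a full period F is back at F x, so simplicity makes it constant in between; but half a
  -- period away it is at another point.
  have key : ∀ δ : ℝ, |δ| = k → φ x + δ ∈ uIcc (φ x) (φ y) → False := by
    intro δ hδ hmem
    obtain ⟨z, hz, hzφ⟩ := intermediate_value_uIcc hφ.continuousOn hmem
    have hzx : F z = F x := by
      rw [hFφ, hFφ, hzφ]
      refine P.boundaryPath_eq_iff.mpr ?_
      rcases abs_eq hk.le |>.mp hδ with h | h
      · exact ⟨1, by rw [h]; simp⟩
      · exact ⟨-1, by rw [h]; simp⟩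
    have hmid : φ x + δ / 2 ∈ uIcc (φ x) (φ z) := by
      rw [hzφ]
      rcases le_total 0 δ with h | h
      · rw [uIcc_of_le (by linarith)]; constructor <;> linarith
      · rw [uIcc_of_ge (by linarith)]; constructor <;> linarith
    obtain ⟨w, hw, hwφ⟩ := intermediate_value_uIcc hφ.continuousOn hmid
    have hwx : F w = F x := (hF (F x)).uIcc_subset (x := x) rfl (y := z) hzx hw
    rw [hFφ, hFφ, hwφ] at hwx
    have hδ2 : |φ x + δ / 2 - φ x| = k / 2 := by
      rw [add_sub_cancel_left, abs_div, hδ, abs_two]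
    have := P.eq_of_boundaryPath_eq hwx (by rw [hδ2]; linarith)
    rw [this, sub_self, abs_zero] at hδ2
    linarith
  rcases le_total (φ x) (φ y) with h | h
  · rw [abs_of_nonpos (by linarith)] at hcon
    refine key k (abs_of_pos hk) ?_
    rw [uIcc_of_le h]; constructor <;> linarith
  · rw [abs_of_nonneg (by linarith)] at hcon
    refine key (-k) (by rw [abs_neg, abs_of_pos hk]) ?_
    rw [uIcc_of_ge h]; constructor <;> linarith

/-- The points strictly between the ends of a simple curve are interior points. -/
theorem IsSimple.mem_interiorPoints (hF : F.IsSimple) {φ : I → ℝ} (hφ : Continuous φ)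
    (hFφ : ∀ x, F x = P.toPolygon.boundaryPath (φ x)) {u : ℝ}
    (hu : u ∈ Ioo (φ 0) (φ 1) ∨ u ∈ Ioo (φ 1) (φ 0)) :
    P.toPolygon.boundaryPath u ∈ F.interiorPoints := by
  have hmem : u ∈ uIcc (φ 0) (φ 1) := by
    rcases hu with h | h
    · exact Icc_subset_uIcc (Ioo_subset_Icc_self h)
    · exact Icc_subset_uIcc' (Ioo_subset_Icc_self h)
  have hne : u ≠ φ 0 ∧ u ≠ φ 1 := by
    rcases hu with h | h
    · exact ⟨h.1.ne', h.2.ne⟩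
    · exact ⟨h.2.ne, h.1.ne'⟩
  obtain ⟨z, -, rfl⟩ := intermediate_value_uIcc hφ.continuousOn hmem
  refine ⟨⟨z, hFφ z⟩, ?_⟩
  rintro (h | h)
  · rw [hFφ 0] at h
    exact hne.1 (P.eq_of_boundaryPath_eq h (hF.abs_sub_lt hφ hFφ _ _))
  · rw [mem_singleton_iff, hFφ 1] at h
    exact hne.2 (P.eq_of_boundaryPath_eq h (hF.abs_sub_lt hφ hFφ _ _))

/-- The distances between oppositely oriented, interior-disjoint curves on the boundary of a
polygon satisfy the Monge inequality. -/
theorem geodist_monge (hRs : R.IsSimple) (hBs : B.IsSimple)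
    (hdisj : Disjoint R.interiorPoints B.interiorPoints) (hR : Forward P R) (hB : Backward P B)
    {x x' y y' : I} (hx : x ≤ x') (hy : y ≤ y') :
    P.geodist (R x) (B y) + P.geodist (R x') (B y') ≤
      P.geodist (R x) (B y') + P.geodist (R x') (B y) := by
  by_cases hRx : R x = R x'
  · rw [hRx, add_comm]
  by_cases hBy : B y = B y'
  · rw [hBy]
  obtain ⟨φ, hφ, hφm, hRφ⟩ := hR
  obtain ⟨ψ₀, hψ₀, hψ₀m, hBψ₀⟩ := hB
  have hk : (0 : ℝ) < k := SimplePolygon.period_pos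
  -- Shift the lift of B by whole periods so that it ends within one period after the start of R.
  set c := toIcoDiv hk (φ 0) (ψ₀ 1)
  have hψ1 : ψ₀ 1 - c * k ∈ Ico (φ 0) (φ 0 + k) := by
    have := toIcoMod_mem_Ico hk (φ 0) (ψ₀ 1)
    rwa [toIcoMod, zsmul_eq_mul] at this
  set ψ : I → ℝ := fun t => ψ₀ t - c * k with hψdef
  have hψ : Continuous ψ := by fun_prop
  have hψm : Antitone ψ := fun s t hst => sub_le_sub_right (hψ₀m hst) _
  have hBψ : ∀ t, B t = P.toPolygon.boundaryPath (ψ t) := fun t => by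
    rw [hBψ₀]
    exact P.boundaryPath_eq_iff.mpr ⟨c, by simp [hψdef]⟩
  replace hψ1 : ψ 1 ∈ Ico (φ 0) (φ 0 + k) := hψ1
  have hφ01 : φ 0 < φ 1 := by
    by_contra! h
    have h1 : ∀ t, φ t = φ 0 := fun t =>
      le_antisymm ((hφm t.2.2).trans h) (hφm t.2.1)
    exact hRx (by rw [hRφ, hRφ, h1, h1 x'])
  have hψ01 : ψ 1 < ψ 0 := by
    by_contra! h
    have h1 : ∀ t, ψ t = ψ 0 := fun t =>
      le_antisymm (hψm t.2.1) (h.trans (hψm t.2.2))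
    exact hBy (by rw [hBψ, hBψ, h1, h1 y'])
  have hno : ∀ u ∈ Ioo (φ 0) (φ 1), ∀ v ∈ Ioo (ψ 1) (ψ 0),
      P.toPolygon.boundaryPath u ≠ P.toPolygon.boundaryPath v := fun u hu v hv h =>
    disjoint_left.mp hdisj (hRs.mem_interiorPoints hφ hRφ (Or.inl hu))
      (h ▸ hBs.mem_interiorPoints hψ hBψ (Or.inr hv))
  -- An overlap of the lifts, directly or modulo the period, would give a common interior point. So
  -- the lift of B lies between φ 1 and φ 0 + k, and the four points occur in the order R x, R x', B
  -- y', B y.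
  have hle₁ : φ 1 ≤ ψ 1 := by
    by_contra! h
    obtain ⟨u, hu1, hu2⟩ := exists_between (lt_min h hψ01)
    exact hno u ⟨hψ1.1.trans_lt hu1, hu2.trans_le (min_le_left _ _)⟩ u
      ⟨hu1, hu2.trans_le (min_le_right _ _)⟩ rfl
  have hle₂ : ψ 0 ≤ φ 0 + k := by
    by_contra! h
    obtain ⟨u, hu1, hu2⟩ := exists_between (lt_min h (add_lt_add_left hφ01 (k : ℝ)))
    refine hno (u - k) ⟨by linarith, by linarith [hu2.trans_le (min_le_right _ _)]⟩ u
      ⟨hψ1.2.trans hu1, hu2.trans_le (min_le_left _ _)⟩ ?_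
    rw [← Polygon.boundaryPath_add_period, sub_add_cancel]
  have h := P.geodist_add_geodist_le_of_interlacing (hφm hx)
    (((hφm x'.2.2).trans hle₁).trans (hψm y'.2.2)) (hψm hy)
    ((hψm y.2.1).trans (hle₂.trans (add_le_add_left (hφm unitInterval.nonneg') _)))
    (hRφ x).symm (hRφ x').symm (hBψ y').symm (hBψ y).symm
  exact h

/-- On every edge of `F`, the points closest to the points of another curve depend continuously and
monotonically on them, if the distances satisfy the Monge inequality. -/
theorem exists_closest_selection {G : PolygonalCurve} (hP : P.GeneralPosition)
    (hG : range G ⊆ P.bdry) (hF : range F ⊆ P.bdry) (hGc : Continuous G) (hFc : Continuous F)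
    (hFs : F.IsSimple)
    (hmonge : ∀ x x' y y' : I, x ≤ x' → y ≤ y' →
      P.geodist (G x) (F y) + P.geodist (G x') (F y') ≤
        P.geodist (G x) (F y') + P.geodist (G x') (F y)) {i : ℕ} (hi : i < F.numEdges) :
    ∃ m : ℝ → ℝ, Continuous m ∧ Monotone m ∧
      (∀ x, IsUnimodal (fun y => P.geodist (G (projIcc 0 1 zero_le_one x))
        (F (projIcc 0 1 zero_le_one y))) (F.knot i) (F.knot (i + 1)) (m x)) ∧
      ∀ x, F.IsVertex (F (projIcc 0 1 zero_le_one (m x))) ∨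
        LocallyClosest P F (F (projIcc 0 1 zero_le_one (m x))) (G (projIcc 0 1 zero_le_one x)) := by
  have hlt := F.knot_lt hi
  have hband : ∀ y ∈ Icc (F.knot i) (F.knot (i + 1)), y ∈ Icc (0 : ℝ) 1 := fun y hy =>
    ⟨(F.knotI i).2.1.trans hy.1, hy.2.trans (F.knotI (i + 1)).2.2⟩
  have hproj : ∀ y ∈ Icc (F.knot i) (F.knot (i + 1)),
      ((projIcc 0 1 zero_le_one y : I) : ℝ) = y := fun y hy => by
    rw [projIcc_of_mem _ (hband y hy)]
  have hknot : ∀ j, (projIcc 0 1 zero_le_one (F.knot j) : I) = F.knotI j := fun j =>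
    projIcc_val zero_le_one (F.knotI j)
  -- On a degenerate edge the distance is constant, and the first knot serves as minimizer.
  by_cases hne : F (F.knotI i) = F (F.knotI (i + 1))
  · have hconst : ∀ y ∈ Icc (F.knot i) (F.knot (i + 1)),
        F (projIcc 0 1 zero_le_one y) = F (F.knotI i) := fun y hy => by
      rw [F.apply_eq_lineMap hi (x := projIcc 0 1 zero_le_one y) (by rwa [hproj y hy]), ← hne,
        AffineMap.lineMap_same_apply]
    refine ⟨fun _ => F.knot i, continuous_const, monotone_const, fun x => ⟨⟨le_rfl, hlt.le⟩, ?_, ?_⟩,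
      fun x => Or.inl (hknot i ▸ F.isVertex_knotI i)⟩
    · rw [Icc_self]
      exact subsingleton_singleton.antitoneOn _
    · intro y hy z hz _
      simp only [hconst y hy, hconst z hz, le_refl]
  · have hc : Continuous fun z : ℝ × ℝ => P.geodist (G (projIcc 0 1 zero_le_one z.1))
        (F (projIcc 0 1 zero_le_one z.2)) :=
      (continuous_geodist hG hF hGc hFc).comp
        (f := fun z : ℝ × ℝ => ((projIcc 0 1 zero_le_one z.1 : I), (projIcc 0 1 zero_le_one z.2 : I)))
        (by fun_prop)
    obtain ⟨m, hmc, hmm, hmu, hmin⟩ := exists_minimum_selection (D := fun x y =>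
        P.geodist (G (projIcc 0 1 zero_le_one x)) (F (projIcc 0 1 zero_le_one y))) hc
      (fun x x' y y' hx hy => hmonge _ _ _ _ (monotone_projIcc _ hx) (monotone_projIcc _ hy)) hlt.le
      (fun r x hx z hz y hy => by
        have hy' : y ∈ Icc (F.knot i) (F.knot (i + 1)) := ⟨hx.1.trans hy.1.le, hy.2.le.trans hz.2⟩
        refine geodist_lt_max hP hF hi hne (hG (mem_range_self _)) (by rwa [hproj x hx])
          (by rwa [hproj z hz]) ?_ ?_
        · exact Subtype.coe_lt_coe.mp (by rw [hproj x hx, hproj y hy']; exact hy.1)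
        · exact Subtype.coe_lt_coe.mp (by rw [hproj z hz, hproj y hy']; exact hy.2))
    refine ⟨m, hmc, hmm, hmu, fun x => ?_⟩
    have hmem := (hmu x).mem
    rcases hmem.1.eq_or_lt with h | h
    · exact Or.inl (h ▸ hknot i ▸ F.isVertex_knotI i)
    rcases hmem.2.eq_or_lt with h' | h'
    · exact Or.inl (h'.symm ▸ hknot (i + 1) ▸ F.isVertex_knotI (i + 1))
    refine Or.inr (hFs.locallyClosest hFc hi hne (by rw [hproj _ hmem]; exact ⟨h, h'⟩) ?_)
    intro y' hy' hne'
    have := hmin x y' hy' fun h => hne' (by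
      refine Subtype.ext ?_
      rw [hproj _ hmem]; exact h)
    simpa only [projIcc_val] using this

end PolygonalCurve

/-! ### Optimal matchings -/

theorem IsReparam.map_zero {f : I → I} (hf : IsReparam f) : f 0 = 0 := by
  obtain ⟨t, ht⟩ := hf.2 0
  exact le_antisymm ((hf.1 unitInterval.nonneg').trans_eq ht) (f 0).2.1

theorem IsReparam.map_one {f : I → I} (hf : IsReparam f) : f 1 = 1 := by
  obtain ⟨t, ht⟩ := hf.2 1
  exact le_antisymm (f 1).2.2 (ht.symm.trans_le (hf.1 unitInterval.le_one'))

theorem IsReparam.continuous {f : I → I} (hf : IsReparam f) : Continuous f :=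
  hf.1.continuous_of_surjective hf.2

/-- The pairs of monotone functions with mean value `t` at every `t`. -/
def balancedPairs : Set ((I → I) × (I → I)) :=
  {p | Monotone p.1 ∧ Monotone p.2 ∧ ∀ t, (p.1 t : ℝ) + p.2 t = 2 * t}

/-- All conditions are closed and pointwise, so the set is compact in the product topology. -/
theorem isClosed_balancedPairs : IsClosed balancedPairs := by
  have h : balancedPairs = (⋂ (s : I) (t : I) (_ : s ≤ t), {p | p.1 s ≤ p.1 t}) ∩
      ((⋂ (s : I) (t : I) (_ : s ≤ t), {p | p.2 s ≤ p.2 t}) ∩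
        ⋂ t : I, {p | (p.1 t : ℝ) + p.2 t = 2 * t}) := by
    ext p
    simp only [balancedPairs, Monotone, mem_ofPred_eq, mem_inter_iff, mem_iInter]
  rw [h]
  refine IsClosed.inter ?_ (IsClosed.inter ?_ ?_)
  · exact isClosed_iInter fun s => isClosed_iInter fun t => isClosed_iInter fun _ =>
      isClosed_le (by fun_prop) (by fun_prop)
  · exact isClosed_iInter fun s => isClosed_iInter fun t => isClosed_iInter fun _ =>
      isClosed_le (by fun_prop) (by fun_prop)
  · exact isClosed_iInter fun t => isClosed_eq (by fun_prop) (by fun_prop)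

/-- Two monotone functions with sum 2t are both 2-Lipschitz, and their values at 0 and 1 are forced.
-/
theorem isReparam_of_mem_balancedPairs {p : (I → I) × (I → I)} (hp : p ∈ balancedPairs) :
    IsReparam p.1 ∧ IsReparam p.2 := by
  have key : ∀ f g : I → I, Monotone f → Monotone g → (∀ t, (f t : ℝ) + g t = 2 * t) →
      IsReparam f := by
    intro f g hf hg h
    have hlip : ∀ s t : I, s ≤ t → (f t : ℝ) - f s ≤ 2 * (t - s) ∧ (0 : ℝ) ≤ f t - f s := by
      intro s t hst
      have h1 : (f s : ℝ) ≤ f t := hf hst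
      have h2 : (g s : ℝ) ≤ g t := hg hst
      constructor <;> linarith [h s, h t]
    have hc : Continuous f := by
      refine LipschitzWith.continuous (K := 2) (LipschitzWith.of_dist_le_mul fun s t => ?_)
      simp only [Subtype.dist_eq, Real.dist_eq, NNReal.coe_ofNat]
      rcases le_total s t with hst | hst
      · have h1 := hlip s t hst
        have h2 : (s : ℝ) ≤ t := hst
        rw [abs_of_nonpos (by linarith), abs_of_nonpos (by linarith)]
        linarith
      · have h1 := hlip t s hst
        have h2 : (t : ℝ) ≤ s := hst
        rw [abs_of_nonneg (by linarith), abs_of_nonneg (by linarith)]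
        linarith
    have h0 : (f 0 : ℝ) = 0 := by
      have := h 0
      rw [Icc.coe_zero] at this
      linarith [(f 0).2.1, (g 0).2.1]
    have h1 : (f 1 : ℝ) = 1 := by
      have := h 1
      rw [Icc.coe_one] at this
      linarith [(f 1).2.2, (g 1).2.2]
    refine ⟨hf, fun y => mem_range_of_exists_le_of_exists_ge hc ⟨0, ?_⟩ ⟨1, ?_⟩⟩
    · exact Subtype.coe_le_coe.mp (h0 ▸ y.2.1)
    · exact Subtype.coe_le_coe.mp (h1 ▸ y.2.2)
  exact ⟨key _ _ hp.1 hp.2.1 hp.2.2, key _ _ hp.2.1 hp.1 fun t => by rw [add_comm]; exact hp.2.2 t⟩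

/-- Every matching can be reparametrized to a balanced one. -/
theorem IsReparam.exists_balanced {f g : I → I} (hf : IsReparam f) (hg : IsReparam g) :
    ∃ p ∈ balancedPairs, ∀ t, ∃ s, p.1 t = f s ∧ p.2 t = g s := by
  have hh : Continuous fun s => ((f s : ℝ) + g s) / 2 := by
    have := hf.continuous
    have := hg.continuous
    fun_prop
  have hsurj : ∀ t : I, ∃ s : I, ((f s : ℝ) + g s) / 2 = t := fun t =>
    mem_range_of_exists_le_of_exists_ge hh ⟨0, by rw [hf.map_zero, hg.map_zero]; simpa using t.2.1⟩
      ⟨1, by rw [hf.map_one, hg.map_one]; simpa using t.2.2⟩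
  choose τ hτ using hsurj
  -- The chosen τ need not be monotone. Where it reverses the order, equality of f and of g is
  -- forced, because their sum cannot decrease.
  have hmono : ∀ s t : I, s ≤ t → f (τ s) ≤ f (τ t) ∧ g (τ s) ≤ g (τ t) := by
    intro s t hst
    rcases le_total (τ s) (τ t) with h | h
    · exact ⟨hf.1 h, hg.1 h⟩
    · have h1 : (f (τ t) : ℝ) ≤ f (τ s) := hf.1 h
      have h2 : (g (τ t) : ℝ) ≤ g (τ s) := hg.1 h
      have h3 : (s : ℝ) ≤ t := hst
      have e1 := hτ s
      have e2 := hτ t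
      exact ⟨Subtype.coe_le_coe.mp (by linarith), Subtype.coe_le_coe.mp (by linarith)⟩
  refine ⟨(f ∘ τ, g ∘ τ), ⟨fun s t h => (hmono s t h).1, fun s t h => (hmono s t h).2, fun t => ?_⟩,
    fun t => ⟨τ t, rfl, rfl⟩⟩
  have := hτ t
  simp only [Function.comp_apply]
  linarith

/-- The Fréchet distance is attained. -/
theorem exists_isFrechetMatching {k : ℕ} [NeZero k] {P : SimplePolygon k} {R B : PolygonalCurve}
    (hd : Continuous fun z : I × I => P.geodist (R z.1) (B z.2)) :
    ∃ f g : I → I, IsFrechetMatching P R B f g := by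
  -- A supremum of functions continuous in the product topology; it attains its minimum on the
  -- compact set of balanced pairs.
  have hlsc : LowerSemicontinuous fun p : (I → I) × (I → I) => matchingCost P R B p.1 p.2 :=
    lowerSemicontinuous_iSup fun t => Continuous.lowerSemicontinuous
      (hd.comp (f := fun p : (I → I) × (I → I) => (p.1 t, p.2 t)) (by fun_prop))
  have hid : ((id, id) : (I → I) × (I → I)) ∈ balancedPairs :=
    ⟨monotone_id, monotone_id, fun t => by simp [two_mul]⟩
  obtain ⟨p, hp, hmin⟩ := (hlsc.lowerSemicontinuousOn _).exists_isMinOn ⟨_, hid⟩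
    isClosed_balancedPairs.isCompact
  have hpr := isReparam_of_mem_balancedPairs hp
  refine ⟨p.1, p.2, hpr.1, hpr.2, le_antisymm ?_ ?_⟩
  · refine le_iInf fun f => le_iInf fun g => le_iInf fun hfg => ?_
    obtain ⟨q, hq, hqs⟩ := hfg.1.exists_balanced hfg.2
    refine (hmin hq).trans (iSup_le fun t => ?_)
    obtain ⟨s, h1, h2⟩ := hqs t
    rw [h1, h2]
    exact le_iSup (fun t => P.geodist (R (f t)) (B (g t))) s
  · exact iInf_le_of_le p.1 (iInf_le_of_le p.2 (iInf_le _ hpr))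

/-! ### Locally correct Fréchet matchings -/

section

variable {k : ℕ} [NeZero k] {P : SimplePolygon k} {R B : PolygonalCurve}

theorem matchingCost_comm (f g : I → I) : matchingCost P R B f g = matchingCost P B R g f :=
  iSup_congr fun _ => P.geodist_comm _ _

theorem frechetDist_comm : frechetDist P R B = frechetDist P B R := by
  rw [frechetDist, iInf_comm, frechetDist]
  simp only [matchingCost_comm (R := R), and_comm]

theorem IsFrechetMatching.swap {f g : I → I} (h : IsFrechetMatching P R B f g) :
    IsFrechetMatching P B R g f :=
  ⟨h.2.1, h.1, by rw [← matchingCost_comm, h.2.2, frechetDist_comm]⟩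

/-- The grid of the vertices of two oppositely oriented, interior-disjoint simple curves, with the
points on the edges that are closest to the points of the other curve. -/
theorem exists_unimodalGrid (hP : P.GeneralPosition) (hR : range R ⊆ P.bdry)
    (hB : range B ⊆ P.bdry) (hRs : R.IsSimple) (hBs : B.IsSimple) (hRc : Continuous R)
    (hBc : Continuous B)
    (hmonge : ∀ x x' y y' : I, x ≤ x' → y ≤ y' →
      P.geodist (R x) (B y) + P.geodist (R x') (B y') ≤
        P.geodist (R x) (B y') + P.geodist (R x') (B y)) :
    ∃ W : UnimodalGrid ℝ≥0∞,
      (∀ x y : I, W.D x y = P.geodist (R x) (B y)) ∧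
      ∀ ε, ∀ x y : I, ((x : ℝ), (y : ℝ)) ∈ W.good ε → R.IsVertex (R x) ∨ B.IsVertex (B y) ∨
        PolygonalCurve.LocallyClosest P R (R x) (B y) ∨
        PolygonalCurve.LocallyClosest P B (B y) (R x) := by
  choose! m hmc hmm hmu hm using fun j (hj : j < B.numEdges) =>
    PolygonalCurve.exists_closest_selection hP hR hB hRc hBc hBs hmonge hj
  choose! n hnc hnm hnu hn using fun i (hi : i < R.numEdges) =>
    PolygonalCurve.exists_closest_selection hP hB hR hBc hRc hRs (fun x x' y y' hx hy => by
      have := hmonge y y' x x' hy hx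
      rw [add_comm (P.geodist (R y) (B x'))] at this
      simpa only [P.geodist_comm (R _)] using this) hi
  refine ⟨{
    D x y := P.geodist (R (projIcc 0 1 zero_le_one x)) (B (projIcc 0 1 zero_le_one y))
    M := R.numEdges
    N := B.numEdges
    X := R.knot
    Y := B.knot
    X_zero := R.knot_zero
    Y_zero := B.knot_zero
    X_last := R.knot_last
    Y_last := B.knot_last
    X_mono := R.knot_mono
    Y_mono := B.knot_mono
    m := m
    n := n
    m_cont := hmc
    m_mono := hmm
    n_cont := hnc
    n_mono := hnm
    m_unimodal := hmu
    n_unimodal := fun i hi y => by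
      simpa only [P.geodist_comm (B _)] using hnu i hi y }, fun x y => ?_, fun ε x y h => ?_⟩
  · simp only [projIcc_val]
  · obtain ⟨-, -, ⟨i, -, hx⟩ | ⟨j, -, hy⟩ | ⟨j, hj, hy⟩ | ⟨i, hi, hx⟩⟩ := h
    · have : x = R.knotI i := Subtype.ext hx
      exact Or.inl (this ▸ R.isVertex_knotI i)
    · have : y = B.knotI j := Subtype.ext hy
      exact Or.inr (Or.inl (this ▸ B.isVertex_knotI j))
    · have := hm j hj x
      dsimp only at hy
      rw [← hy, projIcc_val, projIcc_val] at this
      exact Or.inr (this.imp_right Or.inr)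
    · have := hn i hi y
      dsimp only at hx
      rw [← hx, projIcc_val, projIcc_val] at this
      rcases this with h | h
      · exact Or.inl h
      · exact Or.inr (Or.inr (Or.inl h))

/-- An optimal matching is rerouted with ε equal to its own cost, so the new matching is optimal as
well. -/
theorem exists_isFrechetMatching_of_forward (hP : P.GeneralPosition)
    (hR : range R ⊆ P.bdry) (hB : range B ⊆ P.bdry) (hRs : R.IsSimple) (hBs : B.IsSimple)
    (hdisj : Disjoint R.interiorPoints B.interiorPoints)
    (hRf : PolygonalCurve.Forward P R) (hBb : PolygonalCurve.Backward P B) :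
    ∃ f g : I → I, IsFrechetMatching P R B f g ∧
      ∀ t : I,
        R.IsVertex (R (f t)) ∨ B.IsVertex (B (g t)) ∨
        PolygonalCurve.LocallyClosest P R (R (f t)) (B (g t)) ∨
        PolygonalCurve.LocallyClosest P B (B (g t)) (R (f t)) := by
  have hRc : Continuous R := by
    obtain ⟨φ, hφ, -, h⟩ := hRf
    rw [show (R : I → Plane) = fun x => P.toPolygon.boundaryPath (φ x) from funext h]
    exact P.toPolygon.continuous_boundaryPath.comp hφ
  have hBc : Continuous B := by
    obtain ⟨φ, hφ, -, h⟩ := hBb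
    rw [show (B : I → Plane) = fun x => P.toPolygon.boundaryPath (φ x) from funext h]
    exact P.toPolygon.continuous_boundaryPath.comp hφ
  obtain ⟨W, hD, hgood⟩ := exists_unimodalGrid hP hR hB hRs hBs hRc hBc
    fun x x' y y' hx hy => PolygonalCurve.geodist_monge hRs hBs hdisj hRf hBb hx hy
  obtain ⟨f, g, hfg⟩ :=
    exists_isFrechetMatching (PolygonalCurve.continuous_geodist hR hB hRc hBc)
  have hext : ∀ {f : I → I}, IsReparam f →
      Continuous (fun t : ℝ => (f (projIcc 0 1 zero_le_one t) : ℝ)) ∧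
      Monotone (fun t : ℝ => (f (projIcc 0 1 zero_le_one t) : ℝ)) ∧
      (f (projIcc 0 1 zero_le_one (0 : ℝ)) : ℝ) = 0 ∧
      (f (projIcc 0 1 zero_le_one (1 : ℝ)) : ℝ) = 1 := fun {f} hf =>
    ⟨by have := hf.continuous; fun_prop, fun s t hst => hf.1 (monotone_projIcc _ hst),
      by rw [projIcc_left]; exact congrArg Subtype.val hf.map_zero,
      by rw [projIcc_right]; exact congrArg Subtype.val hf.map_one⟩
  obtain ⟨hf1, hf2, hf3, hf4⟩ := hext hfg.1
  obtain ⟨hg1, hg2, hg3, hg4⟩ := hext hfg.2.1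
  have hmatch : W.IsMatching (fun t : ℝ => f (projIcc 0 1 zero_le_one t))
      (fun t : ℝ => g (projIcc 0 1 zero_le_one t)) (matchingCost P R B f g) :=
    ⟨hf1, hg1, hf2, hg2, hf3, hg3, hf4, hg4, fun t _ => by
      rw [hD]
      exact le_iSup (fun t => P.geodist (R (f t)) (B (g t))) _⟩
  obtain ⟨γ, hγm, hγ⟩ := hmatch.exists_good
  have hf' : IsReparam fun t => (⟨(γ t).1, (hγ t).1.1.1, (hγ t).1.2.1⟩ : I) := by
    refine ⟨fun s t hst => (hγm hst).1, fun y => ?_⟩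
    refine mem_range_of_exists_le_of_exists_ge (by fun_prop) ⟨0, ?_⟩ ⟨1, ?_⟩
    · simp
    · simpa [← Subtype.coe_le_coe] using y.2.2
  have hg' : IsReparam fun t => (⟨(γ t).2, (hγ t).1.1.2, (hγ t).1.2.2⟩ : I) := by
    refine ⟨fun s t hst => (hγm hst).2, fun y => ?_⟩
    refine mem_range_of_exists_le_of_exists_ge (by fun_prop) ⟨0, ?_⟩ ⟨1, ?_⟩
    · simp
    · simpa [← Subtype.coe_le_coe] using y.2.2
  refine ⟨_, _, ⟨hf', hg', le_antisymm ?_ ?_⟩, fun t => hgood _ _ _ (hγ t)⟩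
  · rw [← hfg.2.2]
    refine iSup_le fun t => ?_
    rw [← hD]
    exact (hγ t).2.1
  · exact iInf_le_of_le _ (iInf_le_of_le _ (iInf_le _ ⟨hf', hg'⟩))

end

theorem mainTheorem5 {k : ℕ} [NeZero k] (P : SimplePolygon k) (hP : P.GeneralPosition)
    (R B : PolygonalCurve)
    (hR : range R ⊆ P.bdry) (hB : range B ⊆ P.bdry)
    (hRs : R.IsSimple) (hBs : B.IsSimple)
    (hdisj : Disjoint R.interiorPoints B.interiorPoints)
    (hor : PolygonalCurve.OppositelyOriented P R B) :
    ∃ f g : I → I, IsFrechetMatching P R B f g ∧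
      ∀ t : I,
        R.IsVertex (R (f t)) ∨ B.IsVertex (B (g t)) ∨
        PolygonalCurve.LocallyClosest P R (R (f t)) (B (g t)) ∨
        PolygonalCurve.LocallyClosest P B (B (g t)) (R (f t)) := by
  rcases hor with ⟨hRf, hBb⟩ | ⟨hRb, hBf⟩
  · exact exists_isFrechetMatching_of_forward hP hR hB hRs hBs hdisj hRf hBb
  · obtain ⟨g, f, h, ht⟩ :=
      exists_isFrechetMatching_of_forward hP hB hR hBs hRs hdisj.symm hBf hRb
    refine ⟨f, g, h.swap, fun t => ?_⟩
    rcases ht t with h | h | h | h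
    · exact Or.inr (Or.inl h)
    · exact Or.inl h
    · exact Or.inr (Or.inr (Or.inr h))
    · exact Or.inr (Or.inr (Or.inl h))
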